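/- Let $A$ be a commutative ring, $n\ge 0$ an integer, $M$ an $A$-module, and $0\to P\to F\to M\to 0$ an exact sequence of $A$-modules with $F$ free. Notation. For an $A$-module $E$ let $\mathrm{T}^n_A(E)=E^{\otimes n}$, on which the symmetric group $\mathfrak S_n$ acts by $\sigma(x_1\otimes\dots\otimes x_n)=x_{\sigma^{-1}(1)}\otimes\dots\otimes x_{\sigma^{-1}(n)}$, and let $\mathrm{TS}^n_A(E)=\mathrm{T}^n_A(E)^{\mathfrak S_n}$ be the module of symmetric tensors. The shuffle product of $z\in \mathrm{TS}^k_A(E)$ and $z'\in \mathrm{TS}^l_A(E)$ is $z\times z'=\sum_{\sigma}\sigma(z\otimes z')\in\mathrm{TS}^{k+l}_A(E)$, the sum being over all $\sigma\in\mathfrak S_{k+l}$ with $\sigma(1)<\dots<\sigma(k)$ and $\sigma(k+1)<\dots<\sigma(k+l)$; it makes $\bigoplus_{k\ge0}\mathrm{TS}^k_A(E)$ a commutative graded $A$-algebra. Let $\Gamma_A(E)=\bigoplus_{k\ge 0}\Gamma^k_A(E)$ be the divided power algebra of $E$, with product $\times$ and universal maps $\gamma^k:E\to\Gamma^k_A(E)$.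 The canonical map $\Gamma^n_A(E)\to \mathrm{TS}^n_A(E)$ is the degree $n$ part of the homomorphism of graded $A$-algebras $\Gamma_A(E)\to\bigoplus_k \mathrm{TS}^k_A(E)$ that sends $\gamma^k(x)$ to $x^{\otimes k}$ for all $x\in E$ and $k\ge0$. Let $N$ be the kernel of $\mathrm{T}^n_A(F)\to \mathrm{T}^n_A(M)$, and let $K\subseteq\mathrm{TS}^n_A(F)$ be the image, under the canonical map $\Gamma^n_A(F)\to\mathrm{TS}^n_A(F)$ (an isomorphism, as $F$ is free), of the kernel of $\Gamma^n_A(F)\to\Gamma^n_A(M)$. Then that kernel of $\Gamma^n_A(F)\to\Gamma^n_A(M)$ is the $A$-submodule generated by the elements $\gamma^s(p)\times y$ with $1\le s\le n$, $p\in P$ and $y\in\Gamma^{n-s}_A(F)$, and the canonical map $\Gamma^n_A(M)\to\mathrm{TS}^n_A(M)$ is (a) injective if and only if $K=N^{\mathfrak S_n}$; (b) surjective if and only if $\mathrm{TS}^n_A(F)\to\mathrm{TS}^n_A(M)$ is surjective. Moreover, for every family $(m_i)_{i\in\mathcal I}$ generating $M$, the image of $\mathrm{TS}^n_A(F)$ in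 $\mathrm{TS}^n_A(M)$ is the $A$-submodule generated by the elements $m_\nu=\mathop{\times}_{i\in\mathcal I} m_i^{\otimes\nu_i}$ (products for the shuffle product), where $\nu=(\nu_i)_{i\in\mathcal I}$ runs over the multiindices of finite support with $\sum_{i}\nu_i=n$. -/

import Mathlib

open scoped TensorProduct DirectSum

noncomputable section

namespace SymTensor

section Basic

variable (A : Type*) [CommRing A] (M : Type*) [AddCommGroup M] [Module A M]

/-- The action of a permutation on the `n`-fold tensor power:
`σ (m₁ ⊗ … ⊗ mₙ) = m_{σ⁻¹ 1} ⊗ … ⊗ m_{σ⁻¹ n}`. -/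
def permute (n : ℕ) (σ : Equiv.Perm (Fin n)) : ⨂[A]^n M ≃ₗ[A] ⨂[A]^n M :=
  PiTensorProduct.reindex A (fun _ => M) σ

/-- The module `TSⁿ(M)` of symmetric tensors: the invariants of the symmetric group acting on
the `n`-fold tensor power. -/
def TS (n : ℕ) : Submodule A (⨂[A]^n M) where
  carrier := {z | ∀ σ : Equiv.Perm (Fin n), permute A M n σ z = z}
  add_mem' := fun {a b} ha hb σ => by rw [map_add, ha σ, hb σ]
  zero_mem' := fun σ => map_zero _
  smul_mem' := fun c z hz σ => by rw [map_smul, hz σ]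

/-- The `(k, l)`-shuffles: permutations `σ` of `k + l` letters with `σ 1 < … < σ k` and
`σ (k + 1) < … < σ (k + l)`. -/
def shuffles (k l : ℕ) : Finset (Equiv.Perm (Fin (k + l))) :=
  Finset.univ.filter fun σ =>
    StrictMono (fun i : Fin k => σ (Fin.castAdd l i)) ∧
      StrictMono (fun j : Fin l => σ (Fin.natAdd k j))

/-- The shuffle product `z × z' = ∑ σ (z ⊗ z')`, the sum being over all `(k, l)`-shuffles. -/
def shuffle {k l : ℕ} (z : ⨂[A]^k M) (z' : ⨂[A]^l M) : ⨂[A]^(k + l) M :=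
  ∑ σ ∈ shuffles k l, permute A M (k + l) σ (TensorPower.mulEquiv (z ⊗ₜ[A] z'))

variable {A M}

lemma permute_tprod {n : ℕ} (σ : Equiv.Perm (Fin n)) (f : Fin n → M) :
    permute A M n σ (PiTensorProduct.tprod A f) = PiTensorProduct.tprod A (f ∘ σ.symm) := by
  simp only [permute, PiTensorProduct.reindex_tprod]; rfl

lemma permute_permute {n : ℕ} (σ τ : Equiv.Perm (Fin n)) (z : ⨂[A]^n M) :
    permute A M n τ (permute A M n σ z) = permute A M n (τ * σ) z :=
  PiTensorProduct.reindex_reindex σ τ z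

lemma mulEquiv_tprod {k l : ℕ} (a : Fin k → M) (b : Fin l → M) :
    (TensorPower.mulEquiv (PiTensorProduct.tprod A a ⊗ₜ[A] PiTensorProduct.tprod A b) :
      ⨂[A]^(k + l) M) = PiTensorProduct.tprod A (Fin.append a b) :=
  TensorPower.tprod_mul_tprod A a b

/-- Induction on tensors. -/
lemma tensor_induction {n : ℕ} {p : ⨂[A]^n M → Prop}
    (hs : ∀ (r : A) f, p (r • PiTensorProduct.tprod A f)) (ha : ∀ x y, p x → p y → p (x + y))
    (z : ⨂[A]^n M) : p z :=
  PiTensorProduct.induction_on z hs ha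

end Basic

/-! Auxiliary facts: the shuffle product is realised inside a commutative ring, which gives its
associativity and commutativity. -/

section Realisation

variable (A : Type*) [CommRing A] (M : Type*) [AddCommGroup M] [Module A M]
  [Module Aᵐᵒᵖ M] [IsCentralScalar A M]

/-- An auxiliary commutative ring: the `n`-fold tensor power of the square-zero extension of `A`
by `M`. -/
abbrev Aux (n : ℕ) : Type _ := PiTensorProduct A (fun _ : Fin n => TrivSqZeroExt A M)

variable {A M}

/-- The inclusion `ε_i` of `M` into the `i`-th tensor factor of the auxiliary ring. -/
def eps {n : ℕ} (i : Fin n) : M →ₗ[A] Aux A M n :=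
  (PiTensorProduct.singleAlgHom (R := A) (A := fun _ : Fin n => TrivSqZeroExt A M) i).toLinearMap
    ∘ₗ TrivSqZeroExt.inrHom A M

lemma eps_apply {n : ℕ} (i : Fin n) (m : M) :
    (eps i m : Aux A M n) = PiTensorProduct.tprod A (Pi.mulSingle i (TrivSqZeroExt.inr m)) := rfl

lemma eps_mul_eps {n : ℕ} (i : Fin n) (m m' : M) : (eps i m : Aux A M n) * eps i m' = 0 := by
  simp only [eps, LinearMap.comp_apply, AlgHom.toLinearMap_apply, ← map_mul,
    TrivSqZeroExt.inrHom_apply, TrivSqZeroExt.inr_mul_inr, map_zero]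

/-- `m₁ ⊗ … ⊗ mₖ ↦ ∏ᵢ ε_{w i}(mᵢ)`. -/
def place {k n : ℕ} (w : Fin k → Fin n) : ⨂[A]^k M →ₗ[A] Aux A M n :=
  PiTensorProduct.lift ((MultilinearMap.mkPiAlgebra A (Fin k) (Aux A M n)).compLinearMap
    (fun i => eps (w i)))

lemma place_tprod {k n : ℕ} (w : Fin k → Fin n) (f : Fin k → M) :
    (place w (PiTensorProduct.tprod A f) : Aux A M n) = ∏ i, eps (w i) (f i) := by
  simp [place]

lemma place_permute {k n : ℕ} (w : Fin k → Fin n) (σ : Equiv.Perm (Fin k)) (z : ⨂[A]^k M) :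
    (place w (permute A M k σ z) : Aux A M n) = place (w ∘ σ) z := by
  induction z using tensor_induction with
  | hs r f =>
    simp only [map_smul, permute_tprod, place_tprod]
    congr 1
    rw [← Equiv.prod_comp σ]
    simp
  | ha x y hx hy => simp only [map_add, hx, hy]

lemma place_mul {k l n : ℕ} (w : Fin k → Fin n) (w' : Fin l → Fin n)
    (x : ⨂[A]^k M) (y : ⨂[A]^l M) :
    (place w x : Aux A M n) * place w' y
      = place (Fin.append w w') (TensorPower.mulEquiv (x ⊗ₜ[A] y)) := by
  induction x using tensor_induction with
  | hs r f =>
    induction y using tensor_induction with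
    | hs s g =>
      simp only [TensorProduct.tmul_smul, ← TensorProduct.smul_tmul', map_smul, mulEquiv_tprod,
        place_tprod, Fin.prod_univ_add, Fin.append_left, Fin.append_right]
      rw [smul_comm s r]
      refine (Algebra.smul_mul_assoc r _ _).trans ?_
      congr 1
      exact Algebra.mul_smul_comm s _ _
    | ha x y hx hy => simp only [map_add, mul_add, TensorProduct.tmul_add, hx, hy]
  | ha x y hx hy => simp only [map_add, add_mul, TensorProduct.add_tmul, hx, hy]

lemma place_eq_zero {k n : ℕ} (w : Fin k → Fin n) (hw : ¬ Function.Injective w)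
    (z : ⨂[A]^k M) : (place w z : Aux A M n) = 0 := by
  obtain ⟨i, j, hij, hne⟩ : ∃ i j, w i = w j ∧ i ≠ j := by
    simpa [Function.Injective] using hw
  induction z using tensor_induction with
  | hs r f =>
    rw [map_smul, place_tprod, ← Finset.mul_prod_erase _ _ (Finset.mem_univ i),
      ← Finset.mul_prod_erase _ _ (Finset.mem_erase.2 ⟨hne.symm, Finset.mem_univ j⟩), hij,
      ← mul_assoc, eps_mul_eps, zero_mul, smul_zero]
  | ha x y hx hy => rw [map_add, hx, hy, add_zero]

/-- The sum of all order preserving placements. -/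
def spread (n k : ℕ) : ⨂[A]^k M →ₗ[A] Aux A M n := ∑ s : Fin k ↪o Fin n, place s

lemma spread_apply (n k : ℕ) (z : ⨂[A]^k M) :
    (spread n k z : Aux A M n) = ∑ s : Fin k ↪o Fin n, place s z := by
  simp [spread]

lemma sort_strictMono {k n : ℕ} {w : Fin k → Fin n} (hw : Function.Injective w) :
    StrictMono (w ∘ Tuple.sort w) :=
  (Tuple.monotone_sort w).strictMono_of_injective (hw.comp (Tuple.sort w).injective)

lemma spread_shuffle (n : ℕ) {k l : ℕ} (x : ⨂[A]^k M) (y : ⨂[A]^l M) :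
    (spread n (k + l) (shuffle A M x y) : Aux A M n) = spread n k x * spread n l y := by
  classical
  set t := (TensorPower.mulEquiv (x ⊗ₜ[A] y) : ⨂[A]^(k + l) M) with ht
  have h1 : (spread n (k + l) (shuffle A M x y) : Aux A M n) =
      ∑ p ∈ shuffles k l ×ˢ (Finset.univ : Finset (Fin (k + l) ↪o Fin n)),
        place (p.2 ∘ p.1) t := by
    rw [Finset.sum_product]
    simp only [shuffle, map_sum, spread_apply, place_permute]
    rfl
  have h2 : (spread n k x : Aux A M n) * spread n l y =
      ∑ p ∈ (Finset.univ : Finset ((Fin k ↪o Fin n) × (Fin l ↪o Fin n))).filter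
          (fun p => Function.Injective (Fin.append p.1 p.2)),
        place (Fin.append p.1 p.2) t := by
    rw [Finset.sum_filter_of_ne, spread_apply, spread_apply, Finset.sum_mul_sum,
      ← Finset.univ_product_univ, Finset.sum_product]
    · simp only [place_mul, ht]
    · intro p _ hp
      by_contra hinj
      exact hp (place_eq_zero _ hinj _)
  rw [h1, h2]
  have key : ∀ (u : Fin (k + l) → Fin n) (σ : Equiv.Perm (Fin (k + l))),
      Fin.append (fun i => u (σ (Fin.castAdd l i))) (fun j => u (σ (Fin.natAdd k j))) = u ∘ σ := by
    intro u σ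
    funext i
    refine Fin.addCases (fun i => ?_) (fun j => ?_) i <;> simp
  refine Finset.sum_bij
    (fun p hp => (OrderEmbedding.ofStrictMono (fun i => p.2 (p.1 (Fin.castAdd l i)))
        (p.2.strictMono.comp (Finset.mem_filter.1 (Finset.mem_product.1 hp).1).2.1),
      OrderEmbedding.ofStrictMono (fun j => p.2 (p.1 (Fin.natAdd k j)))
        (p.2.strictMono.comp (Finset.mem_filter.1 (Finset.mem_product.1 hp).1).2.2)))
    ?_ ?_ ?_ ?_
  · intro p hp
    simp only [Finset.mem_filter, Finset.mem_univ, true_and, OrderEmbedding.coe_ofStrictMono, key]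
    exact p.2.injective.comp p.1.injective
  · intro p hp p' hp' h
    have hc : p.2 ∘ p.1 = p'.2 ∘ p'.1 := by
      rw [Prod.ext_iff] at h
      have ha := congrArg (fun s : Fin k ↪o Fin n => (s : Fin k → Fin n)) h.1
      have hb := congrArg (fun s : Fin l ↪o Fin n => (s : Fin l → Fin n)) h.2
      simp only [OrderEmbedding.coe_ofStrictMono] at ha hb
      rw [← key p.2 p.1, ← key p'.2 p'.1, ha, hb]
    have hr : Set.range p.2 = Set.range p'.2 := by
      rw [← p.1.surjective.range_comp p.2, ← p'.1.surjective.range_comp p'.2, hc]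
    have h2 : p.2 = p'.2 := by
      ext1 i
      exact congrFun ((StrictMono.range_inj p.2.strictMono p'.2.strictMono).1 hr) i
    refine Prod.ext (Equiv.ext fun i => ?_) h2
    have := congrFun hc i
    rw [h2] at this
    exact p'.2.injective this
  · intro q hq
    have hinj := (Finset.mem_filter.1 hq).2
    set w := Fin.append q.1 q.2 with hw
    set ρ := Tuple.sort w with hρ
    have hsm : StrictMono (w ∘ ρ) := sort_strictMono hinj
    have hwu : ∀ i, (w ∘ ρ) (ρ.symm i) = w i := by simp
    refine ⟨(ρ.symm, OrderEmbedding.ofStrictMono _ hsm), ?_, ?_⟩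
    · simp only [Finset.mem_product, shuffles, Finset.mem_filter, Finset.mem_univ, true_and,
        and_true]
      constructor
      · intro i j hij
        rw [← hsm.lt_iff_lt, hwu, hwu]
        simpa [hw] using hij
      · intro i j hij
        rw [← hsm.lt_iff_lt, hwu, hwu]
        simpa [hw] using hij
    · refine Prod.ext ?_ ?_
      · ext1; simp [hw]
      · ext1; simp [hw]
  · intro p hp
    simp only [OrderEmbedding.coe_ofStrictMono, key]

/-- The projection of the auxiliary ring onto its top component, the tensor power. -/
def topProj (n : ℕ) : Aux A M n →ₗ[A] ⨂[A]^n M :=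
  PiTensorProduct.map (fun _ => TrivSqZeroExt.sndHom A M)

lemma place_tprod_eq {k n : ℕ} (w : Fin k → Fin n) (f : Fin k → M) :
    (place w (PiTensorProduct.tprod A f) : Aux A M n) =
      PiTensorProduct.tprod A
        (∏ i, Pi.mulSingle (w i) (TrivSqZeroExt.inr (f i)) : Fin n → TrivSqZeroExt A M) := by
  rw [place_tprod, PiTensorProduct.tprod_prod]
  rfl

lemma top_spread_self (n : ℕ) (z : ⨂[A]^n M) : topProj n (spread n n z) = z := by
  have hu : (Finset.univ : Finset (Fin n ↪o Fin n)) = {(OrderIso.refl (Fin n)).toOrderEmbedding} := by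
    ext s
    simp only [Finset.mem_univ, Finset.mem_singleton, true_iff]
    ext1 i
    exact congrFun ((StrictMono.range_inj s.strictMono strictMono_id).1
      (by rw [(Finite.injective_iff_surjective.1 s.injective).range_eq]; simp)) i
  induction z using tensor_induction with
  | hs r f =>
    rw [map_smul, map_smul]
    congr 1
    rw [spread_apply, hu, Finset.sum_singleton, place_tprod_eq, topProj, PiTensorProduct.map_tprod]
    congr 1
    funext j
    rw [Finset.prod_apply, Finset.prod_eq_single j]
    · simp
    · intro b _ hb
      simp [hb.symm]
    · simp
  | ha x y hx hy => simp only [map_add, hx, hy]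

lemma top_spread_ne {n k : ℕ} (h : k ≠ n) (z : ⨂[A]^k M) : topProj n (spread n k z) = 0 := by
  rw [spread_apply, map_sum]
  refine Finset.sum_eq_zero fun s _ => ?_
  have hns : ¬ Function.Surjective s := fun hs =>
    h (by simpa using Fintype.card_of_bijective ⟨s.injective, hs⟩)
  obtain ⟨j, hj⟩ := not_forall.1 hns
  induction z using tensor_induction with
  | hs r f =>
    rw [map_smul, map_smul, place_tprod_eq, topProj, PiTensorProduct.map_tprod,
      (PiTensorProduct.tprod A).map_coord_zero j, smul_zero]
    rw [Finset.prod_apply, Finset.prod_eq_one]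
    · simp
    · intro i _
      rw [Pi.mulSingle_eq_of_ne]
      exact fun hij => hj ⟨i, hij.symm⟩
  | ha x y hx hy => simp only [map_add, hx, hy, add_zero]

lemma spread_zero_one (n : ℕ) :
    (spread n 0 (PiTensorProduct.tprod A (Fin.elim0 : Fin 0 → M)) : Aux A M n) = 1 := by
  have : Unique (Fin 0 ↪o Fin n) :=
    { default := OrderEmbedding.ofStrictMono Fin.elim0 (fun i => i.elim0)
      uniq := fun s => by ext i; exact i.elim0 }
  rw [spread_apply, Fintype.sum_unique, place_tprod]
  simp

/-- The elementary symmetric expressions in the `ε_i(x)`. -/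
lemma spread_pow (n k : ℕ) (x : M) :
    (spread n k (PiTensorProduct.tprod A fun _ => x) : Aux A M n) =
      ∑ S ∈ Finset.powersetCard k Finset.univ, ∏ j ∈ S, eps j x := by
  rw [spread_apply]
  refine Finset.sum_bij (fun s _ => Finset.univ.map s.toEmbedding) ?_ ?_ ?_ ?_
  · intro s _
    simp [Finset.mem_powersetCard]
  · intro s _ s' _ h
    ext1 i
    refine congrFun ((StrictMono.range_inj s.strictMono s'.strictMono).1 ?_) i
    have := congrArg (fun S : Finset (Fin n) => (S : Set (Fin n))) h
    simpa using this
  · intro S hS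
    refine ⟨S.orderEmbOfFin (Finset.mem_powersetCard.1 hS).2, Finset.mem_univ _, ?_⟩
    rw [← Finset.coe_inj]
    simp
  · intro s _
    rw [place_tprod, Finset.prod_map]
    rfl

lemma esymm_mul {R ι : Type*} [CommRing R] [Fintype ι] [DecidableEq ι] (a b : ι → R)
    (h : ∀ i, a i * b i = 0) (k l : ℕ) :
    (∑ S ∈ Finset.powersetCard k Finset.univ, ∏ j ∈ S, a j) *
        (∑ S ∈ Finset.powersetCard l Finset.univ, ∏ j ∈ S, b j) =
      ∑ U ∈ Finset.powersetCard (k + l) Finset.univ, ∑ S ∈ Finset.powersetCard k U,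
        (∏ j ∈ S, a j) * ∏ j ∈ U \ S, b j := by
  rw [Finset.sum_mul_sum, ← Finset.sum_product', Finset.sum_sigma']
  rw [← Finset.sum_filter_of_ne (p := fun p => Disjoint p.1 p.2)]
  · refine Finset.sum_bij' (fun p _ => ⟨p.1 ∪ p.2, p.1⟩) (fun q _ => (q.2, q.1 \ q.2)) ?_ ?_ ?_ ?_ ?_
    · rintro ⟨S, T⟩ hp
      simp only [Finset.mem_filter, Finset.mem_product, Finset.mem_powersetCard] at hp
      simp [Finset.mem_powersetCard, Finset.card_union_of_disjoint hp.2, hp.1.1.2, hp.1.2.2]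
    · rintro ⟨U, S⟩ hq
      simp only [Finset.mem_sigma, Finset.mem_powersetCard] at hq
      simp [Finset.mem_powersetCard, hq.2.2, Finset.card_sdiff_of_subset hq.2.1, hq.1.2,
        Finset.disjoint_sdiff]
    · rintro ⟨S, T⟩ hp
      simp only [Finset.mem_filter] at hp
      simp [Finset.union_sdiff_cancel_left hp.2]
    · rintro ⟨U, S⟩ hq
      simp only [Finset.mem_sigma, Finset.mem_powersetCard] at hq
      simp [Finset.union_sdiff_of_subset hq.2.1]
    · rintro ⟨S, T⟩ hp
      simp only [Finset.mem_filter] at hp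
      simp [Finset.union_sdiff_cancel_left hp.2]
  · rintro ⟨S, T⟩ _ hne
    by_contra hd
    obtain ⟨i, hi, hi'⟩ := Finset.not_disjoint_iff.1 hd
    refine hne ?_
    simp only
    rw [← Finset.mul_prod_erase S a hi, ← Finset.mul_prod_erase T b hi']
    linear_combination (∏ x ∈ S.erase i, a x) * (∏ x ∈ T.erase i, b x) * h i

end Realisation

section Algebra

variable {A : Type*} [CommRing A] {M : Type*} [AddCommGroup M] [Module A M]

/-- The permutations that sort the two blocks of `σ`. -/
def blockSort {k l : ℕ} (σ : Equiv.Perm (Fin (k + l))) :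
    Equiv.Perm (Fin k) × Equiv.Perm (Fin l) :=
  (Tuple.sort fun i => σ (Fin.castAdd l i), Tuple.sort fun j => σ (Fin.natAdd k j))

/-- The permutation of `k + l` letters acting on the two blocks separately. -/
def blockPerm {k l : ℕ} (p : Equiv.Perm (Fin k) × Equiv.Perm (Fin l)) :
    Equiv.Perm (Fin (k + l)) :=
  finSumFinEquiv.permCongr (Equiv.sumCongr p.1 p.2)

lemma blockPerm_castAdd {k l : ℕ} (p : Equiv.Perm (Fin k) × Equiv.Perm (Fin l)) (i : Fin k) :
    blockPerm p (Fin.castAdd l i) = Fin.castAdd l (p.1 i) := by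
  simp [blockPerm, Equiv.permCongr_apply]

lemma blockPerm_natAdd {k l : ℕ} (p : Equiv.Perm (Fin k) × Equiv.Perm (Fin l)) (j : Fin l) :
    blockPerm p (Fin.natAdd k j) = Fin.natAdd k (p.2 j) := by
  simp [blockPerm, Equiv.permCongr_apply]

lemma permute_blockPerm {k l : ℕ} (p : Equiv.Perm (Fin k) × Equiv.Perm (Fin l))
    (x : ⨂[A]^k M) (y : ⨂[A]^l M) :
    permute A M (k + l) (blockPerm p) (TensorPower.mulEquiv (x ⊗ₜ[A] y)) =
      TensorPower.mulEquiv (permute A M k p.1 x ⊗ₜ[A] permute A M l p.2 y) := by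
  induction x using tensor_induction with
  | hs r f =>
    induction y using tensor_induction with
    | hs s g =>
      simp only [TensorProduct.tmul_smul, ← TensorProduct.smul_tmul', map_smul, mulEquiv_tprod,
        permute_tprod]
      congr 3
      funext i
      obtain ⟨i, rfl⟩ := (blockPerm p).surjective i
      simp only [Function.comp_apply, Equiv.symm_apply_apply]
      refine Fin.addCases (fun i => ?_) (fun j => ?_) i
      · simp [blockPerm_castAdd]
      · simp [blockPerm_natAdd]
    | ha x y hx hy => simp only [map_add, TensorProduct.tmul_add, hx, hy]
  | ha x y hx hy => simp only [map_add, TensorProduct.add_tmul, hx, hy]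

/-- The shuffle in the coset `σ (S_k × S_l)`. -/
def toShuffle {k l : ℕ} (σ : Equiv.Perm (Fin (k + l))) : Equiv.Perm (Fin (k + l)) :=
  σ * blockPerm (blockSort σ)

lemma toShuffle_mem {k l : ℕ} (σ : Equiv.Perm (Fin (k + l))) : toShuffle σ ∈ shuffles k l := by
  simp only [shuffles, Finset.mem_filter, Finset.mem_univ, true_and, toShuffle,
    Equiv.Perm.mul_apply, blockPerm_castAdd, blockPerm_natAdd]
  exact ⟨sort_strictMono (σ.injective.comp (Fin.castAdd_injective k l)),
    sort_strictMono (σ.injective.comp (Fin.natAdd_injective l k))⟩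

lemma perm_ext_blocks {k l : ℕ} {σ τ : Equiv.Perm (Fin (k + l))}
    (h1 : (fun i : Fin k => σ (Fin.castAdd l i)) = fun i => τ (Fin.castAdd l i))
    (h2 : (fun j : Fin l => σ (Fin.natAdd k j)) = fun j => τ (Fin.natAdd k j)) : σ = τ :=
  Equiv.ext fun i => Fin.addCases (fun i => congrFun h1 i) (fun j => congrFun h2 j) i

lemma toShuffle_mul_blockPerm {k l : ℕ} (σ : Equiv.Perm (Fin (k + l)))
    (p : Equiv.Perm (Fin k) × Equiv.Perm (Fin l)) :
    toShuffle (σ * blockPerm p) = toShuffle σ := by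
  apply perm_ext_blocks
  · simp only [toShuffle, Equiv.Perm.mul_apply, blockPerm_castAdd, blockSort]
    exact Tuple.comp_perm_comp_sort_eq_comp_sort
      (f := fun i : Fin k => σ (Fin.castAdd l i)) (σ := p.1)
  · simp only [toShuffle, Equiv.Perm.mul_apply, blockPerm_natAdd, blockSort]
    exact Tuple.comp_perm_comp_sort_eq_comp_sort
      (f := fun j : Fin l => σ (Fin.natAdd k j)) (σ := p.2)

lemma toShuffle_of_mem {k l : ℕ} {σ : Equiv.Perm (Fin (k + l))} (h : σ ∈ shuffles k l) :
    toShuffle σ = σ := by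
  simp only [shuffles, Finset.mem_filter, Finset.mem_univ, true_and] at h
  have h1 := Tuple.sort_eq_refl_iff_monotone.2 h.1.monotone
  have h2 := Tuple.sort_eq_refl_iff_monotone.2 h.2.monotone
  apply perm_ext_blocks
  · simp only [toShuffle, Equiv.Perm.mul_apply, blockPerm_castAdd, blockSort, h1]
    rfl
  · simp only [toShuffle, Equiv.Perm.mul_apply, blockPerm_natAdd, blockSort, h2]
    rfl

lemma permute_toShuffle {k l : ℕ} (σ : Equiv.Perm (Fin (k + l))) {x : ⨂[A]^k M} {y : ⨂[A]^l M}
    (hx : x ∈ TS A M k) (hy : y ∈ TS A M l) :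
    permute A M (k + l) (toShuffle σ) (TensorPower.mulEquiv (x ⊗ₜ[A] y)) =
      permute A M (k + l) σ (TensorPower.mulEquiv (x ⊗ₜ[A] y)) := by
  rw [toShuffle, ← permute_permute, permute_blockPerm, hx, hy]

/-- The shuffle product of two symmetric tensors is symmetric. -/
lemma shuffle_mem {k l : ℕ} {x : ⨂[A]^k M} {y : ⨂[A]^l M}
    (hx : x ∈ TS A M k) (hy : y ∈ TS A M l) : shuffle A M x y ∈ TS A M (k + l) := by
  intro τ
  rw [shuffle, map_sum]
  simp only [permute_permute]
  have key : ∀ τ σ : Equiv.Perm (Fin (k + l)), σ ∈ shuffles k l →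
      toShuffle (τ⁻¹ * toShuffle (k := k) (l := l) (τ * σ)) = σ := by
    intro τ σ hσ
    have : τ⁻¹ * toShuffle (k := k) (l := l) (τ * σ) = σ * blockPerm (blockSort (τ * σ)) := by
      rw [toShuffle, ← mul_assoc, ← mul_assoc, inv_mul_cancel, one_mul]
    rw [this, toShuffle_mul_blockPerm, toShuffle_of_mem hσ]
  refine Finset.sum_bij' (fun σ _ => toShuffle (τ * σ)) (fun σ _ => toShuffle (τ⁻¹ * σ))
    (fun σ _ => toShuffle_mem _) (fun σ _ => toShuffle_mem _) (fun σ hσ => key τ σ hσ)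
    (fun σ hσ => ?_) (fun σ _ => ?_)
  · simpa using key τ⁻¹ σ hσ
  · exact (permute_toShuffle _ hx hy).symm

lemma pow_mem (n : ℕ) (x : M) : PiTensorProduct.tprod A (fun _ : Fin n => x) ∈ TS A M n :=
  fun σ => permute_tprod σ _

lemma one_mem : PiTensorProduct.tprod A (Fin.elim0 : Fin 0 → M) ∈ TS A M 0 := fun σ => by
  
  exact (permute_tprod σ _).trans (congrArg (PiTensorProduct.tprod A) (Subsingleton.elim _ _))

variable (A) in
/-- The symmetric tensor `x ⊗ … ⊗ x`. -/
def tensorPow (n : ℕ) (x : M) : TS A M n := ⟨PiTensorProduct.tprod A (fun _ => x), pow_mem n x⟩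

instance : GradedMonoid.GOne (fun k => TS A M k) where
  one := ⟨PiTensorProduct.tprod A Fin.elim0, one_mem⟩

/-- The multiplication on `⨁ₖ TSᵏ(M)` is the shuffle product. -/
instance : GradedMonoid.GMul (fun k => TS A M k) where
  mul x y := ⟨shuffle A M x.1 y.1, shuffle_mem x.2 y.2⟩

lemma coe_gMul {k l : ℕ} (x : TS A M k) (y : TS A M l) :
    (GradedMonoid.GMul.mul (A := fun k => TS A M k) x y).1 = shuffle A M x.1 y.1 := rfl

lemma shuffle_add {k l : ℕ} (x : ⨂[A]^k M) (y z : ⨂[A]^l M) :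
    shuffle A M x (y + z) = shuffle A M x y + shuffle A M x z := by
  simp only [shuffle, TensorProduct.tmul_add, map_add, Finset.sum_add_distrib]

lemma add_shuffle {k l : ℕ} (x y : ⨂[A]^k M) (z : ⨂[A]^l M) :
    shuffle A M (x + y) z = shuffle A M x z + shuffle A M y z := by
  simp only [shuffle, TensorProduct.add_tmul, map_add, Finset.sum_add_distrib]

lemma smul_shuffle {k l : ℕ} (r : A) (x : ⨂[A]^k M) (z : ⨂[A]^l M) :
    shuffle A M (r • x) z = r • shuffle A M x z := by
  simp only [shuffle, ← TensorProduct.smul_tmul', map_smul, Finset.smul_sum]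

lemma shuffle_smul {k l : ℕ} (r : A) (x : ⨂[A]^k M) (z : ⨂[A]^l M) :
    shuffle A M x (r • z) = r • shuffle A M x z := by
  simp only [shuffle, TensorProduct.tmul_smul, map_smul, Finset.smul_sum]

lemma graded_ext [Module Aᵐᵒᵖ M] [IsCentralScalar A M] {x y : GradedMonoid (fun k => TS A M k)}
    (h : x.1 = y.1) (h' : ∀ n, (spread n x.1 x.2.1 : Aux A M n) = spread n y.1 y.2.1) :
    x = y := by
  obtain ⟨k, x⟩ := x
  obtain ⟨l, y⟩ := y
  obtain rfl : k = l := h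
  congr 1
  ext1
  rw [← top_spread_self (A := A) k x.1, h' k, top_spread_self]

lemma graded_mul_fst (x y : GradedMonoid (fun k => TS A M k)) : (x * y).1 = x.1 + y.1 := rfl

lemma graded_one_fst : (1 : GradedMonoid (fun k => TS A M k)).1 = 0 := rfl

lemma graded_spread_mul [Module Aᵐᵒᵖ M] [IsCentralScalar A M]
    (x y : GradedMonoid (fun k => TS A M k)) (n : ℕ) :
    (spread n (x * y).1 (x * y).2.1 : Aux A M n) = spread n x.1 x.2.1 * spread n y.1 y.2.1 :=
  spread_shuffle n x.2.1 y.2.1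

lemma graded_spread_one [Module Aᵐᵒᵖ M] [IsCentralScalar A M] (n : ℕ) :
    (spread n (1 : GradedMonoid (fun k => TS A M k)).1
      (1 : GradedMonoid (fun k => TS A M k)).2.1 : Aux A M n) = 1 :=
  spread_zero_one n

section Transfer

lemma graded_mul_one (x : GradedMonoid (fun k => TS A M k)) : x * 1 = x := by
  let _ : Module Aᵐᵒᵖ M := Module.compHom _ ((RingHom.id A).fromOpposite mul_comm)
  have _ : IsCentralScalar A M := ⟨fun r m => rfl⟩
  refine graded_ext (add_zero _) fun n => ?_
  rw [graded_spread_mul, graded_spread_one, mul_one]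

lemma graded_mul_comm (x y : GradedMonoid (fun k => TS A M k)) : x * y = y * x := by
  let _ : Module Aᵐᵒᵖ M := Module.compHom _ ((RingHom.id A).fromOpposite mul_comm)
  have _ : IsCentralScalar A M := ⟨fun r m => rfl⟩
  refine graded_ext (add_comm _ _) fun n => ?_
  rw [graded_spread_mul, graded_spread_mul, mul_comm]

lemma graded_mul_assoc (x y z : GradedMonoid (fun k => TS A M k)) : x * y * z = x * (y * z) := by
  let _ : Module Aᵐᵒᵖ M := Module.compHom _ ((RingHom.id A).fromOpposite mul_comm)
  have _ : IsCentralScalar A M := ⟨fun r m => rfl⟩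
  refine graded_ext (add_assoc _ _ _) fun n => ?_
  simp only [graded_spread_mul, mul_assoc]

end Transfer

/-- `⨁ₖ TSᵏ(M)` with the shuffle product is a commutative graded ring. -/
instance : DirectSum.GCommRing (fun k => TS A M k) where
  one_mul x := by rw [graded_mul_comm, graded_mul_one]
  mul_one := graded_mul_one
  mul_assoc := graded_mul_assoc
  mul_comm := graded_mul_comm
  mul_zero x := Subtype.ext (by simpa [coe_gMul] using shuffle_smul (0 : A) x.1 0)
  zero_mul x := Subtype.ext (by simpa [coe_gMul] using smul_shuffle (0 : A) 0 x.1)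
  mul_add x y z := Subtype.ext (shuffle_add _ _ _)
  add_mul x y z := Subtype.ext (add_shuffle _ _ _)
  natCast m := m • GradedMonoid.GOne.one (A := fun k => TS A M k)
  natCast_zero := zero_smul _ _
  natCast_succ m := by rw [add_smul, one_smul]
  intCast m := m • GradedMonoid.GOne.one (A := fun k => TS A M k)
  intCast_ofNat m := natCast_zsmul _ _
  intCast_negSucc_ofNat m := by rw [negSucc_zsmul]

lemma graded_smul_one_mul (r : A) (x : GradedMonoid (fun k => TS A M k)) :
    GradedMonoid.mk 0 (r • GradedMonoid.GOne.one (A := fun k => TS A M k)) * x = r • x := by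
  let _ : Module Aᵐᵒᵖ M := Module.compHom _ ((RingHom.id A).fromOpposite mul_comm)
  have _ : IsCentralScalar A M := ⟨fun r m => rfl⟩
  refine graded_ext (zero_add _) fun n => ?_
  rw [graded_spread_mul]
  change spread n 0 (r • PiTensorProduct.tprod A Fin.elim0) * spread n x.1 x.2.1 =
    spread n x.1 (r • x.2.1)
  rw [map_smul, map_smul, spread_zero_one]
  exact (Algebra.smul_mul_assoc r 1 _).trans (congrArg (r • ·) (one_mul _))

/-- `⨁ₖ TSᵏ(M)` is a graded `A`-algebra. -/
instance : DirectSum.GAlgebra A (fun k => TS A M k) where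
  toFun := ((LinearMap.id : A →ₗ[A] A).smulRight
    (GradedMonoid.GOne.one (A := fun k => TS A M k))).toAddMonoidHom
  map_one := one_smul A (GradedMonoid.GOne.one (A := fun k => TS A M k))
  map_mul r s := by
    refine Eq.trans ?_ (graded_smul_one_mul r
      (GradedMonoid.mk 0 (s • GradedMonoid.GOne.one (A := fun k => TS A M k)))).symm
    exact congrArg (GradedMonoid.mk 0) (mul_smul r s _)
  commutes r x := graded_mul_comm _ _
  smul_def r x := (graded_smul_one_mul r x).symm

lemma of_mul_of_spread {k l : ℕ} (x : TS A M k) (y : TS A M l) :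
    DirectSum.of (fun k => TS A M k) k x * DirectSum.of (fun k => TS A M k) l y =
      DirectSum.of (fun k => TS A M k) (k + l)
        ⟨shuffle A M x.1 y.1, shuffle_mem x.2 y.2⟩ :=
  DirectSum.of_mul_of _ _

/-- The sum of all the maps `spread`. -/
def spreadAll [Module Aᵐᵒᵖ M] [IsCentralScalar A M] (n : ℕ) :
    (⨁ k, TS A M k) →ₗ[A] Aux A M n :=
  DirectSum.toModule A ℕ _ fun k => spread n k ∘ₗ (TS A M k).subtype

lemma spreadAll_of [Module Aᵐᵒᵖ M] [IsCentralScalar A M] (n k : ℕ) (x : TS A M k) :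
    (spreadAll n (DirectSum.of (fun k => TS A M k) k x) : Aux A M n) = spread n k x.1 :=
  DirectSum.toModule_lof A (φ := fun k => spread n k ∘ₗ (TS A M k).subtype) k x

lemma spreadAll_of_mul_of [Module Aᵐᵒᵖ M] [IsCentralScalar A M] (n k l : ℕ) (x : TS A M k)
    (y : TS A M l) :
    (spreadAll n (DirectSum.of (fun k => TS A M k) k x * DirectSum.of (fun k => TS A M k) l y) :
      Aux A M n) = spread n k x.1 * spread n l y.1 := by
  rw [of_mul_of_spread, spreadAll_of, spread_shuffle]

lemma spreadAll_ext [Module Aᵐᵒᵖ M] [IsCentralScalar A M] {x y : ⨁ k, TS A M k}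
    (h : ∀ n, (spreadAll n x : Aux A M n) = spreadAll n y) : x = y := by
  have key : ∀ (n : ℕ) (z : ⨁ k, TS A M k), topProj n (spreadAll n z) = (z n).1 := by
    intro n z
    induction z using DirectSum.induction_on with
    | zero => simp
    | of k z =>
      rw [spreadAll_of]
      by_cases hk : k = n
      · subst hk
        rw [top_spread_self, DirectSum.of_eq_same]
      · rw [top_spread_ne hk, DirectSum.of_eq_of_ne _ _ _ (Ne.symm hk)]
        rfl
    | add x y hx hy => simp [hx, hy]
  refine DFinsupp.ext fun n => Subtype.ext ?_
  have := congrArg (topProj n) (h n)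
  rwa [key, key] at this

lemma spread_tensorPow [Module Aᵐᵒᵖ M] [IsCentralScalar A M] (n k : ℕ) (x : M) :
    (spread n k (tensorPow A k x).1 : Aux A M n) =
      ∑ S ∈ Finset.powersetCard k Finset.univ, ∏ j ∈ S, eps j x :=
  spread_pow n k x

variable (A) in
/-- `x ⊗ … ⊗ x`, viewed in degree `k` of the graded ring `⨁ₖ TSᵏ(M)`. -/
def tsPow (k : ℕ) (x : M) : ⨁ k, TS A M k := DirectSum.of (fun k => TS A M k) k (tensorPow A k x)

lemma tsPow_zero (x : M) : tsPow A 0 x = 1 := by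
  refine congrArg (DirectSum.of (fun k => TS A M k) 0) (Subtype.ext ?_)
  exact congrArg (PiTensorProduct.tprod A) (Subsingleton.elim _ _)

lemma tsPow_smul (k : ℕ) (r : A) (x : M) : tsPow A k (r • x) = r ^ k • tsPow A k x := by
  rw [tsPow, tsPow, ← DirectSum.of_smul]
  congr 1
  refine Subtype.ext ?_
  have := (PiTensorProduct.tprod A).map_smul_univ (fun _ : Fin k => r) (fun _ => x)
  rw [Finset.prod_const, Finset.card_univ, Fintype.card_fin] at this
  exact this

lemma tsPow_mul (k l : ℕ) (x : M) :
    tsPow A k x * tsPow A l x = (k + l).choose k • tsPow A (k + l) x := by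
  let _ : Module Aᵐᵒᵖ M := Module.compHom _ ((RingHom.id A).fromOpposite mul_comm)
  have _ : IsCentralScalar A M := ⟨fun r m => rfl⟩
  refine spreadAll_ext fun n => ?_
  rw [map_nsmul, tsPow, tsPow, tsPow, spreadAll_of_mul_of, spreadAll_of, spread_tensorPow,
    spread_tensorPow, spread_tensorPow, esymm_mul _ _ (fun i => eps_mul_eps i x x)]
  refine Eq.trans ?_ (Finset.sum_nsmul _ _ _)
  refine Finset.sum_congr rfl fun U hU => ?_
  rw [Finset.sum_congr rfl (g := fun _ => ∏ j ∈ U, eps j x), Finset.sum_const,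
    Finset.card_powersetCard, (Finset.mem_powersetCard.1 hU).2]
  intro S hS
  rw [mul_comm, Finset.prod_sdiff (Finset.mem_powersetCard.1 hS).1]

lemma tsPow_add (k : ℕ) (x y : M) :
    tsPow A k (x + y) = ∑ p ∈ Finset.HasAntidiagonal.antidiagonal k, tsPow A p.1 x * tsPow A p.2 y := by
  let _ : Module Aᵐᵒᵖ M := Module.compHom _ ((RingHom.id A).fromOpposite mul_comm)
  have _ : IsCentralScalar A M := ⟨fun r m => rfl⟩
  refine spreadAll_ext fun n => ?_
  simp only [map_sum, tsPow, spreadAll_of_mul_of, spreadAll_of, spread_tensorPow]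
  simp only [esymm_mul (fun i => (eps i x : Aux A M n)) (fun i => eps i y)
    (fun i => eps_mul_eps i x y)]
  symm
  rw [Finset.sum_congr rfl (g := fun p : ℕ × ℕ => ∑ U ∈ Finset.powersetCard k Finset.univ,
    ∑ S ∈ Finset.powersetCard p.1 U, (∏ j ∈ S, (eps j x : Aux A M n)) * ∏ j ∈ U \ S, eps j y)]
  · rw [Finset.sum_comm]
    refine Finset.sum_congr rfl fun U hU => ?_
    symm
    simp only [map_add]
    rw [Finset.prod_add, Finset.sum_powerset, (Finset.mem_powersetCard.1 hU).2,
      Finset.Nat.sum_antidiagonal_eq_sum_range_succ_mk]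
  · intro p hp
    rw [Finset.HasAntidiagonal.mem_antidiagonal.1 hp]

end Algebra

section Main

variable (A : Type*) [CommRing A] (M : Type*) [AddCommGroup M] [Module A M]

/-- The degree `n` part `Γⁿ(M)` of the divided power algebra `Γ(M)`: the image of the polynomials
in the variables `(k, x)`, standing for `γᵏ(x)`, that are homogeneous of degree `n` when `(k, x)`
has degree `k`. -/
def Gam (n : ℕ) : Submodule A (DividedPowerAlgebra A M) :=
  (MvPolynomial.weightedHomogeneousSubmodule A (Prod.fst : ℕ × M → ℕ) n).map
    (RingCon.mkₐ A (DividedPowerAlgebra.ringCon A M)).toLinearMap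

/-- The homomorphism of `A`-algebras `Γ(M) → ⨁ₖ TSᵏ(M)` with `γᵏ(x) ↦ x ⊗ … ⊗ x`. -/
def canonicalAlgHom : DividedPowerAlgebra A M →ₐ[A] ⨁ k, TS A M k :=
  DividedPowerAlgebra.lift' (M := M) (f := fun p => tsPow A p.1 p.2) tsPow_zero
    (fun k r x => tsPow_smul k r x) tsPow_mul tsPow_add

/-- The canonical map `Γⁿ(M) → TSⁿ(M)`: the degree `n` part of `canonicalAlgHom`. -/
def canonicalMap (n : ℕ) : Gam A M n →ₗ[A] TS A M n :=
  DirectSum.component A ℕ (fun k => TS A M k) n ∘ₗ (canonicalAlgHom A M).toLinearMap ∘ₗ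
    (Gam A M n).subtype

variable {A M}

lemma canonicalAlgHom_dp (n : ℕ) (x : M) :
    canonicalAlgHom A M (DividedPowerAlgebra.dp A n x) = tsPow A n x :=
  DividedPowerAlgebra.lift'_apply_dp (f := fun p => tsPow A p.1 p.2) _ _ _ _ n x

lemma dp_mem (n : ℕ) (x : M) : DividedPowerAlgebra.dp A n x ∈ Gam A M n :=
  ⟨MvPolynomial.X (n, x), MvPolynomial.isWeightedHomogeneous_X _ _ (n, x), rfl⟩

/-- The canonical map sends `γⁿ(x)` to `x ⊗ … ⊗ x`. -/
lemma canonicalMap_dp (n : ℕ) (x : M) :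
    canonicalMap A M n ⟨DividedPowerAlgebra.dp A n x, dp_mem n x⟩ = tensorPow A n x := by
  change (canonicalAlgHom A M (DividedPowerAlgebra.dp A n x)) n = _
  rw [canonicalAlgHom_dp]
  exact DirectSum.of_eq_same _ _

/-- A homomorphism out of `Γ(M)` that sends every `γᵏ(x)` into degree `k` respects degrees. -/
lemma map_mem_of_mem_Gam {B : Type*} [CommSemiring B] [Algebra A B] (𝓑 : ℕ → Submodule A B)
    [SetLike.GradedMonoid 𝓑] (φ : DividedPowerAlgebra A M →ₐ[A] B)
    (h : ∀ k x, φ (DividedPowerAlgebra.dp A k x) ∈ 𝓑 k) (n : ℕ) {y : DividedPowerAlgebra A M}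
    (hy : y ∈ Gam A M n) : φ y ∈ 𝓑 n := by
  obtain ⟨p, hp, rfl⟩ := hy
  have hφ : φ ((RingCon.mkₐ A (DividedPowerAlgebra.ringCon A M)).toLinearMap p) =
      MvPolynomial.aeval (fun kx : ℕ × M => φ (DividedPowerAlgebra.dp A kx.1 kx.2)) p := by
    change (φ.comp (RingCon.mkₐ A (DividedPowerAlgebra.ringCon A M))) p = _
    rw [MvPolynomial.aeval_unique (φ.comp (RingCon.mkₐ A (DividedPowerAlgebra.ringCon A M)))]
    rfl
  rw [hφ, MvPolynomial.aeval_def, MvPolynomial.eval₂_eq]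
  refine Submodule.sum_mem _ fun d hd => ?_
  rw [← Algebra.smul_def]
  refine Submodule.smul_mem _ _ ?_
  rw [← hp (MvPolynomial.mem_support_iff.1 hd), Finsupp.weight_apply]
  exact SetLike.prod_mem_graded 𝓑 _ _ fun i _ => SetLike.pow_mem_graded _ (h i.1 i.2)

instance : SetLike.GradedMonoid (Gam A M) where
  one_mem := ⟨1, MvPolynomial.isWeightedHomogeneous_one A _,
    map_one (RingCon.mkₐ A (DividedPowerAlgebra.ringCon A M))⟩
  mul_mem := by
    rintro k l _ _ ⟨p, hp, rfl⟩ ⟨q, hq, rfl⟩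
    exact ⟨p * q, MvPolynomial.IsWeightedHomogeneous.mul hp hq,
      map_mul (RingCon.mkₐ A (DividedPowerAlgebra.ringCon A M)) p q⟩

instance : SetLike.GradedMonoid
    (fun n => LinearMap.range (DirectSum.lof A ℕ (fun k => TS A M k) n)) where
  one_mem := ⟨_, rfl⟩
  mul_mem := by
    rintro k l _ _ ⟨x, rfl⟩ ⟨y, rfl⟩
    exact ⟨_, (DirectSum.of_mul_of (A := fun k => TS A M k) x y).symm⟩

/-- The homomorphism `canonicalAlgHom` respects degrees. -/
lemma of_canonicalMap (n : ℕ) (y : Gam A M n) :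
    DirectSum.of (fun k => TS A M k) n (canonicalMap A M n y) = canonicalAlgHom A M y := by
  obtain ⟨z, hz⟩ := map_mem_of_mem_Gam (B := ⨁ k, TS A M k)
    (fun n => LinearMap.range (DirectSum.lof A ℕ (fun k => TS A M k) n)) (canonicalAlgHom A M)
    (fun k x => by
      rw [canonicalAlgHom_dp]
      exact ⟨tensorPow A k x, rfl⟩) n y.2
  change DirectSum.of (fun k => TS A M k) n ((canonicalAlgHom A M y) n) = _
  rw [← hz]
  exact congrArg (DirectSum.of (fun k => TS A M k) n) (DirectSum.of_eq_same (β := fun k => TS A M k) n z)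

variable {F : Type*} [AddCommGroup F] [Module A F]

/-- The map `Γⁿ(F) → Γⁿ(M)` induced by a linear map `q : F → M`. -/
def gamMap (q : F →ₗ[A] M) (n : ℕ) : Gam A F n →ₗ[A] Gam A M n :=
  (DividedPowerAlgebra.map A q).toLinearMap.restrict fun _ hy =>
    map_mem_of_mem_Gam (Gam A M) (DividedPowerAlgebra.map A q)
      (fun k x => by
        rw [DividedPowerAlgebra.map_apply_dp]
        exact dp_mem k (q x)) n hy

/-- The map `Tⁿ(F) → Tⁿ(M)` induced by a linear map `q : F → M`. -/
def tensorMap (q : F →ₗ[A] M) (n : ℕ) : ⨂[A]^n F →ₗ[A] ⨂[A]^n M :=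
  PiTensorProduct.map fun _ => q

/-- The map `TSⁿ(F) → TSⁿ(M)` induced by a linear map `q : F → M`. -/
def tsMap (q : F →ₗ[A] M) (n : ℕ) : TS A F n →ₗ[A] TS A M n :=
  (tensorMap q n).restrict fun z hz σ =>
    (PiTensorProduct.map_reindex (fun _ => q) σ z).symm.trans (congrArg (tensorMap q n) (hz σ))

/-- The kernel of `Γⁿ(F) → Γⁿ(M)`, viewed as a submodule of `TSⁿ(F)` through the canonical map
`Γⁿ(F) → TSⁿ(F)`. -/
def kernelK (q : F →ₗ[A] M) (n : ℕ) : Submodule A (TS A F n) :=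
  (LinearMap.ker (gamMap q n)).map (canonicalMap A F n)

/-- The invariants `N^{Sₙ}` of the kernel `N` of `Tⁿ(F) → Tⁿ(M)`, as a submodule of `TSⁿ(F)`. -/
def kernelInvariants (q : F →ₗ[A] M) (n : ℕ) : Submodule A (TS A F n) :=
  (LinearMap.ker (tensorMap q n)).comap (TS A F n).subtype

/-- The product `m_ν = ×ᵢ mᵢ^{⊗ νᵢ}`, taken in the graded ring `⨁ₖ TSᵏ(M)` for the shuffle
product. -/
def shuffleMonomial {ι : Type*} (m : ι → M) (ν : ι →₀ ℕ) : ⨁ k, TS A M k :=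
  ν.prod fun i k => tsPow A k (m i)

end Main

end SymTensor

end

/-!
Everything rests on two facts about `Γ`.

The first is the description of the kernel of `Γ(F) → Γ(M)` for a surjection `q : F → M`. Let `I` be
the ideal of `Γ(F)` generated by the `γˢ(p)` with `s ≥ 1` and `p` in the kernel of `q`. By the
addition formula, `γⁿ(x)` modulo `I` depends on `q x` only, so that `Γ(F) → Γ(F) / I` factors
through `Γ(M)` and the kernel is contained in `I` (`ker_map_le_dpIdeal`). The homomorphism
`Γ(M) → Γ(M)[T]`, `γᵏ(x) ↦ γᵏ(x) Tᵏ` provides the projections onto the homogeneous components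
(`homogenize`, `gamProj`), and the degree `n` part of `I` is read off (`ker_gamMap`).

The second is that `Γⁿ(F) → TSⁿ(F)` is bijective for free `F` (`canonicalMap_bijective`).
Let `(eᵢ)` be a basis. The `∏ᵢ γ^{νᵢ}(eᵢ)` with `|ν| = n` generate `Γⁿ(F)` (`span_prod_dp`), and
their images are the shuffle monomials `e_ν`. In the basis `e_{f 1} ⊗ … ⊗ e_{f n}` of the tensor power, the coordinate
of `e_ν` at `f` is `1` if `νᵢ = #f⁻¹(i)` for all `i`, and `0` otherwise (`repr_shuffleMonomial`):
thus `e_ν` is the sum over one orbit of the symmetric group on the basis, and these orbit sums form a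
basis of the invariants. The coordinate is computed in the auxiliary ring that realises the shuffle
product (`dualProd_shuffleMonomial`), where a product of elementary symmetric polynomials takes the
place of the sum over shuffles.

The rest is a diagram chase. The canonical map is natural (`tsMap_canonicalMap`), and in the square
formed by `Γⁿ(F) → Γⁿ(M)`, `TSⁿ(F) → TSⁿ(M)` and the two canonical maps, the first map is surjective
and the canonical map of `F` is bijective. Hence the canonical map of `M` has the same range as
`TSⁿ(F) → TSⁿ(M)`, and it is injective if and only if the kernels of `Γⁿ(F) → Γⁿ(M)` and of
`TSⁿ(F) → TSⁿ(M)` correspond. Generators of the common range come from generators of `Γⁿ(M)`.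
-/

noncomputable section

namespace SymTensor

variable {A : Type*} [CommRing A] {M : Type*} [AddCommGroup M] [Module A M]

open DividedPowerAlgebra

/-! ### The grading of the divided power algebra -/

variable (A M) in
/-- The homomorphism `Γ(M) → Γ(M)[T]` with `γᵏ(x) ↦ γᵏ(x) Tᵏ`. Its coefficients are the projections
onto the homogeneous components. -/
def homogenize : DividedPowerAlgebra A M →ₐ[A] Polynomial (DividedPowerAlgebra A M) :=
  lift' (M := M) (f := fun p => Polynomial.monomial p.1 (dp A p.1 p.2))
    (fun m => by simp [dp_zero])
    (fun n r m => by rw [dp_smul, Polynomial.smul_monomial])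
    (fun n p m => by rw [Polynomial.monomial_mul_monomial, dp_mul, map_nsmul])
    (fun n u v => by
      rw [dp_add, map_sum]
      refine Finset.sum_congr rfl fun k hk => ?_
      exact (Polynomial.monomial_mul_monomial k.1 k.2 _ _).trans
        (by rw [Finset.HasAntidiagonal.mem_antidiagonal.1 hk]) |>.symm)

lemma homogenize_dp (k : ℕ) (x : M) :
    homogenize A M (dp A k x) = Polynomial.monomial k (dp A k x) :=
  lift'_apply_dp (f := fun p => Polynomial.monomial p.1 (dp A p.1 p.2)) _ _ _ _ k x

/-- The projection of `Γ(M)` onto its component of degree `n`. -/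
def gamProj (n : ℕ) : DividedPowerAlgebra A M →ₗ[A] DividedPowerAlgebra A M :=
  (Polynomial.lcoeff (DividedPowerAlgebra A M) n).restrictScalars A ∘ₗ
    (homogenize A M).toLinearMap

lemma gamProj_apply (n : ℕ) (y : DividedPowerAlgebra A M) :
    gamProj n y = (homogenize A M y).coeff n := rfl

lemma gamProj_dp_mul (n k : ℕ) (x : M) (y : DividedPowerAlgebra A M) :
    gamProj n (dp A k x * y) = if k ≤ n then dp A k x * gamProj (n - k) y else 0 := by
  rw [gamProj_apply, map_mul, homogenize_dp, ← Polynomial.C_mul_X_pow_eq_monomial, mul_assoc,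
    Polynomial.coeff_C_mul, Polynomial.coeff_X_pow_mul', mul_ite, mul_zero, gamProj_apply]

lemma gamProj_algebraMap (n : ℕ) (a : A) :
    gamProj n (algebraMap A (DividedPowerAlgebra A M) a) =
      if n = 0 then algebraMap A (DividedPowerAlgebra A M) a else 0 := by
  rw [gamProj_apply, AlgHom.commutes, Polynomial.algebraMap_apply, Polynomial.coeff_C]

lemma gamProj_mem (n : ℕ) (y : DividedPowerAlgebra A M) : gamProj n y ∈ Gam A M n := by
  induction y using DividedPowerAlgebra.induction_on generalizing n with
  | C a =>
    rw [gamProj_algebraMap]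
    split_ifs with h
    · subst h
      rw [Algebra.algebraMap_eq_smul_one]
      exact Submodule.smul_mem _ _ (SetLike.GradedOne.one_mem (A := Gam A M))
    · exact zero_mem _
  | add f g hf hg => rw [map_add]; exact add_mem (hf n) (hg n)
  | dp f k x hf =>
    rw [mul_comm, gamProj_dp_mul]
    split_ifs with h
    · have := SetLike.GradedMul.mul_mem (dp_mem (A := A) k x) (hf (n - k))
      rwa [Nat.add_sub_cancel' h] at this
    · exact zero_mem _

lemma eval_one_homogenize (y : DividedPowerAlgebra A M) : (homogenize A M y).eval 1 = y := by
  have : ((Polynomial.aeval (R := DividedPowerAlgebra A M)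
      (1 : DividedPowerAlgebra A M)).restrictScalars A).comp (homogenize A M) = AlgHom.id A _ := by
    refine DividedPowerAlgebra.algHom_ext fun k x => ?_
    simp [homogenize_dp]
  simpa using DFunLike.congr_fun this y

variable (A) in
/-- The monomials of degree `n` over `B`, as an `A`-submodule of the polynomial ring. -/
def monomials (B : Type*) [CommSemiring B] [Algebra A B] (n : ℕ) : Submodule A (Polynomial B) :=
  LinearMap.range ((Polynomial.monomial n : B →ₗ[B] Polynomial B).restrictScalars A)

instance {B : Type*} [CommSemiring B] [Algebra A B] :
    SetLike.GradedMonoid (monomials A B) where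
  one_mem := ⟨1, rfl⟩
  mul_mem := by
    rintro k l _ _ ⟨x, rfl⟩ ⟨y, rfl⟩
    exact ⟨x * y, (Polynomial.monomial_mul_monomial k l x y).symm⟩

lemma homogenize_of_mem {n : ℕ} {y : DividedPowerAlgebra A M} (hy : y ∈ Gam A M n) :
    homogenize A M y = Polynomial.monomial n y := by
  obtain ⟨z, hz⟩ := map_mem_of_mem_Gam
    (monomials A (DividedPowerAlgebra A M)) (homogenize A M)
    (fun k x => ⟨dp A k x, (homogenize_dp k x).symm⟩) n hy
  have h := eval_one_homogenize y
  rw [← hz] at h ⊢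
  simp only [LinearMap.coe_restrictScalars, Polynomial.eval_monomial, one_pow, mul_one] at h
  rw [h]
  rfl

lemma gamProj_of_mem {n : ℕ} {y : DividedPowerAlgebra A M} (hy : y ∈ Gam A M n) :
    gamProj n y = y := by
  rw [gamProj_apply, homogenize_of_mem hy, Polynomial.coeff_monomial_same]

lemma gamProj_of_mem_of_ne {n k : ℕ} (h : k ≠ n) {y : DividedPowerAlgebra A M}
    (hy : y ∈ Gam A M k) : gamProj n y = 0 := by
  rw [gamProj_apply, homogenize_of_mem hy, Polynomial.coeff_monomial_of_ne _ h.symm]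

lemma prod_dp_mem {ι : Type*} (m : ι → M) (ν : ι →₀ ℕ) :
    (ν.prod fun i k => dp A k (m i)) ∈ Gam A M ν.degree :=
  SetLike.prod_mem_graded (Gam A M) _ _ fun i _ => dp_mem (ν i) (m i)

/-- If `(mᵢ)` generates `M`, then the products `∏ᵢ γ^{νᵢ}(mᵢ)` with `|ν| = n` generate `Γⁿ(M)`. -/
lemma span_prod_dp {ι : Type*} {m : ι → M} (hm : Submodule.span A (Set.range m) = ⊤) (n : ℕ) :
    Submodule.span A {z | ∃ ν : ι →₀ ℕ, ν.degree = n ∧ z = ν.prod fun i k => dp A k (m i)} =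
      Gam A M n := by
  refine le_antisymm (Submodule.span_le.2 ?_) fun y hy => ?_
  · rintro _ ⟨ν, rfl, rfl⟩
    exact prod_dp_mem m ν
  · rw [← gamProj_of_mem hy]
    have : y ∈ Submodule.span A (Set.range fun ν : ι →₀ ℕ => ν.prod fun i k => dp A k (m i)) := by
      rw [submodule_span_prod_dp_eq_top hm]
      trivial
    clear hy
    induction this using Submodule.span_induction with
    | mem x hx =>
      obtain ⟨ν, rfl⟩ := hx
      by_cases h : ν.degree = n
      · subst h
        simp only [gamProj_of_mem (prod_dp_mem m ν)]
        exact Submodule.subset_span ⟨ν, rfl, rfl⟩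
      · simp only [gamProj_of_mem_of_ne h (prod_dp_mem m ν)]
        exact zero_mem _
    | zero => rw [map_zero]; exact zero_mem _
    | add x y _ _ hx hy => rw [map_add]; exact add_mem hx hy
    | smul a x _ hx => rw [map_smul]; exact Submodule.smul_mem _ _ hx

/-! ### The kernel of a map of divided power algebras -/

section Kernel

variable {F : Type*} [AddCommGroup F] [Module A F] (q : F →ₗ[A] M)

/-- The ideal of `Γ(F)` generated by the `γˢ(p)` with `s ≥ 1` and `p` in the kernel of `q`. -/
def dpIdeal : Ideal (DividedPowerAlgebra A F) :=
  Ideal.span {z | ∃ s, 1 ≤ s ∧ ∃ p ∈ LinearMap.ker q, z = dp A s p}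

variable {q}

/-- Modulo `dpIdeal q`, the class of `γⁿ(x)` depends on `q x` only. -/
lemma mk_dp_eq {x y : F} (h : q x = q y) (n : ℕ) :
    Ideal.Quotient.mk (dpIdeal q) (dp A n x) = Ideal.Quotient.mk (dpIdeal q) (dp A n y) := by
  have hxy : x = (x - y) + y := by abel
  -- only the term without a positive divided power of `x - y` survives modulo the ideal
  rw [hxy, dp_add, map_sum, Finset.sum_eq_single (0, n)]
  · rw [dp_zero, one_mul]
  · rintro ⟨k, l⟩ hkl hne
    refine Ideal.Quotient.eq_zero_iff_mem.2 (Ideal.mul_mem_right _ _ (Ideal.subset_span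
      ⟨k, Nat.one_le_iff_ne_zero.2 ?_, x - y, by simp [h], rfl⟩))
    rintro rfl
    exact hne (by simpa using hkl)
  · simp

/-- For surjective `q`, the kernel of `Γ(q)` lies in the ideal `dpIdeal q`: the projection
`Γ(F) → Γ(F) / dpIdeal q` factors through `Γ(M)`, the factorisation sending `γᵏ(q x)` to the class
of `γᵏ(x)`. -/
lemma ker_map_le_dpIdeal (hq : Function.Surjective q) :
    RingHom.ker (DividedPowerAlgebra.map A q) ≤ dpIdeal q := by
  set s := Function.surjInv hq
  have hs : ∀ x, q (s x) = x := Function.surjInv_eq hq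
  let ψ : DividedPowerAlgebra A M →ₐ[A] DividedPowerAlgebra A F ⧸ dpIdeal q :=
    lift' (M := M) (f := fun p => Ideal.Quotient.mk (dpIdeal q) (dp A p.1 (s p.2)))
      (fun m => by simp [dp_zero])
      (fun n r m => by
        rw [mk_dp_eq (y := r • s m) (by simp [hs]), dp_smul]
        exact map_smul (Ideal.Quotient.mkₐ A (dpIdeal q)) _ _)
      (fun n p m => by rw [← map_mul, dp_mul, map_nsmul])
      (fun n u v => by
        rw [mk_dp_eq (y := s u + s v) (by simp [hs]), dp_add, map_sum]
        simp)
  have hψ : ψ.comp (DividedPowerAlgebra.map A q) = Ideal.Quotient.mkₐ A (dpIdeal q) := by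
    refine DividedPowerAlgebra.algHom_ext (R := A) (M := F)
      (A := DividedPowerAlgebra A F ⧸ dpIdeal q) fun k x => ?_
    rw [AlgHom.comp_apply, map_apply_dp]
    refine (lift'_apply_dp (f := fun p => Ideal.Quotient.mk (dpIdeal q) (dp A p.1 (s p.2)))
      _ _ _ _ k (q x)).trans ?_
    exact mk_dp_eq (hs _) k
  intro y hy
  refine Ideal.Quotient.eq_zero_iff_mem.1 ?_
  have := DFunLike.congr_fun hψ y
  rw [AlgHom.comp_apply, (RingHom.mem_ker).1 hy, map_zero] at this
  exact this.symm

lemma gamMap_apply (n : ℕ) (y : Gam A F n) :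
    (gamMap q n y : DividedPowerAlgebra A M) = DividedPowerAlgebra.map A q y := rfl

/-- The kernel of `Γⁿ(F) → Γⁿ(M)` is generated by the `γˢ(p) × y`: it is the degree `n` part of
`dpIdeal q`. -/
lemma ker_gamMap (hq : Function.Surjective q) (n : ℕ) :
    (LinearMap.ker (gamMap q n)).map (Gam A F n).subtype =
      Submodule.span A {z | ∃ s, 1 ≤ s ∧ s ≤ n ∧ ∃ p ∈ LinearMap.ker q, ∃ y ∈ Gam A F (n - s),
        z = dp A s p * y} := by
  refine le_antisymm ?_ (Submodule.span_le.2 ?_)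
  · rintro _ ⟨z, hz, rfl⟩
    have hz' : (z : DividedPowerAlgebra A F) ∈ dpIdeal q :=
      ker_map_le_dpIdeal hq (congrArg Subtype.val (LinearMap.mem_ker.1 hz))
    change (z : DividedPowerAlgebra A F) ∈ _
    rw [← gamProj_of_mem z.2]
    generalize (z : DividedPowerAlgebra A F) = w at hz'
    rw [dpIdeal, ← Set.image_id {z | _}, Ideal.span] at hz'
    induction hz' using Submodule.closure_induction with
    | zero => rw [map_zero]; exact zero_mem _
    | add x y _ _ hx hy => rw [map_add]; exact add_mem hx hy
    | smul_mem a x hx =>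
      obtain ⟨_, ⟨s, hs, p, hp, rfl⟩, rfl⟩ := hx
      rw [id, smul_eq_mul, mul_comm, gamProj_dp_mul]
      split_ifs with h
      · exact Submodule.subset_span ⟨s, hs, h, p, hp, _, gamProj_mem _ _, rfl⟩
      · exact zero_mem _
  · rintro _ ⟨s, hs, hsn, p, hp, y, hy, rfl⟩
    have hm := SetLike.GradedMul.mul_mem (dp_mem (A := A) s p) hy
    rw [Nat.add_sub_cancel' hsn] at hm
    refine ⟨⟨_, hm⟩, LinearMap.mem_ker.2 (Subtype.ext ?_), rfl⟩
    rw [gamMap_apply, map_mul, map_apply_dp, LinearMap.mem_ker.1 hp,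
      dp_null_of_ne_zero (Nat.one_le_iff_ne_zero.1 hs), zero_mul]
    rfl

lemma gamMap_surjective (hq : Function.Surjective q) (n : ℕ) :
    Function.Surjective (gamMap q n) := by
  intro y
  have hy := y.2
  replace hy := (span_prod_dp (m := q) (by rw [hq.range_eq, Submodule.span_univ]) n).ge hy
  suffices h : (y : DividedPowerAlgebra A M) ∈
      (Gam A F n).map (DividedPowerAlgebra.map A q).toLinearMap by
    obtain ⟨x, hx, hxy⟩ := h
    exact ⟨⟨x, hx⟩, Subtype.ext hxy⟩
  refine Submodule.span_le.2 ?_ hy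
  rintro _ ⟨ν, rfl, rfl⟩
  refine ⟨_, prod_dp_mem id ν, ?_⟩
  simp [Finsupp.prod]

end Kernel

/-! ### Functoriality of symmetric tensors -/

section Functoriality

variable {F : Type*} [AddCommGroup F] [Module A F] (q : F →ₗ[A] M)

lemma tensorMap_permute {n : ℕ} (σ : Equiv.Perm (Fin n)) (z : ⨂[A]^n F) :
    tensorMap q n (permute A F n σ z) = permute A M n σ (tensorMap q n z) :=
  PiTensorProduct.map_reindex (fun _ => q) σ z

lemma tensorMap_tprod {n : ℕ} (f : Fin n → F) :
    tensorMap q n (PiTensorProduct.tprod A f) = PiTensorProduct.tprod A fun i => q (f i) :=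
  PiTensorProduct.map_tprod _ _

lemma tensorMap_mulEquiv {k l : ℕ} (x : ⨂[A]^k F) (y : ⨂[A]^l F) :
    tensorMap q (k + l) (TensorPower.mulEquiv (x ⊗ₜ[A] y)) =
      TensorPower.mulEquiv (tensorMap q k x ⊗ₜ[A] tensorMap q l y) := by
  induction x using tensor_induction with
  | hs r f =>
    induction y using tensor_induction with
    | hs s g =>
      simp only [TensorProduct.tmul_smul, ← TensorProduct.smul_tmul', map_smul, mulEquiv_tprod,
        tensorMap_tprod]
      congr 3
      funext i
      refine Fin.addCases (fun i => ?_) (fun j => ?_) i <;> simp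
    | ha x y hx hy => simp only [map_add, TensorProduct.tmul_add, hx, hy]
  | ha x y hx hy => simp only [map_add, TensorProduct.add_tmul, hx, hy]

lemma tensorMap_shuffle {k l : ℕ} (x : ⨂[A]^k F) (y : ⨂[A]^l F) :
    tensorMap q (k + l) (shuffle A F x y) = shuffle A M (tensorMap q k x) (tensorMap q l y) := by
  simp only [shuffle, map_sum, tensorMap_permute, tensorMap_mulEquiv]

/-- The homomorphism of graded algebras `⨁ₖ TSᵏ(F) → ⨁ₖ TSᵏ(M)` induced by a linear map. -/
def tsAlgHom : (⨁ k, TS A F k) →ₐ[A] ⨁ k, TS A M k :=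
  DirectSum.toAlgebra A (fun k => TS A F k)
    (fun k => DirectSum.lof A ℕ (fun k => TS A M k) k ∘ₗ tsMap q k)
    (congrArg (DirectSum.of (fun k => TS A M k) 0) (Subtype.ext
      ((tensorMap_tprod q _).trans (congrArg (PiTensorProduct.tprod A) (Subsingleton.elim _ _)))))
    (fun x y => (congrArg (DirectSum.of (fun k => TS A M k) _)
      (Subtype.ext (tensorMap_shuffle q x.1 y.1))).trans (DirectSum.of_mul_of _ _).symm)

lemma tsAlgHom_of (k : ℕ) (x : TS A F k) :
    tsAlgHom q (DirectSum.of (fun k => TS A F k) k x) =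
      DirectSum.of (fun k => TS A M k) k (tsMap q k x) :=
  DirectSum.toModule_lof A (φ := fun k => DirectSum.lof A ℕ (fun k => TS A M k) k ∘ₗ tsMap q k) k x

lemma tsAlgHom_comp_canonicalAlgHom :
    (tsAlgHom q).comp (canonicalAlgHom A F) =
      (canonicalAlgHom A M).comp (DividedPowerAlgebra.map A q) := by
  refine DividedPowerAlgebra.algHom_ext (R := A) (M := F) (A := ⨁ k, TS A M k) fun k x => ?_
  rw [AlgHom.comp_apply, AlgHom.comp_apply, map_apply_dp, canonicalAlgHom_dp, canonicalAlgHom_dp,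
    tsPow, tsAlgHom_of]
  exact congrArg (DirectSum.of (fun k => TS A M k) k) (Subtype.ext (tensorMap_tprod q _))

/-- The canonical map is natural. -/
lemma tsMap_canonicalMap (n : ℕ) (y : Gam A F n) :
    tsMap q n (canonicalMap A F n y) = canonicalMap A M n (gamMap q n y) := by
  refine DirectSum.of_injective (β := fun k => TS A M k) n ?_
  rw [← tsAlgHom_of, of_canonicalMap, of_canonicalMap, gamMap_apply]
  exact DFunLike.congr_fun (tsAlgHom_comp_canonicalAlgHom q) y.1

end Functoriality

lemma canonicalMap_eq (n : ℕ) (y : Gam A M n) :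
    canonicalMap A M n y = canonicalAlgHom A M y n := rfl

lemma canonicalAlgHom_prod_dp {ι : Type*} (m : ι → M) (ν : ι →₀ ℕ) :
    canonicalAlgHom A M (ν.prod fun i k => dp A k (m i)) = shuffleMonomial m ν := by
  simp only [Finsupp.prod, map_prod, canonicalAlgHom_dp, shuffleMonomial]

/-- If `(mᵢ)` generates `M`, then the image of the canonical map is generated by the shuffle
monomials in the `mᵢ`. -/
lemma map_lof_range_canonicalMap {ι : Type*} {m : ι → M}
    (hm : Submodule.span A (Set.range m) = ⊤) (n : ℕ) :
    (LinearMap.range (canonicalMap A M n)).map (DirectSum.lof A ℕ (fun k => TS A M k) n) =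
      Submodule.span A {z | ∃ ν : ι →₀ ℕ, ν.degree = n ∧ z = shuffleMonomial m ν} := by
  have h : DirectSum.lof A ℕ (fun k => TS A M k) n ∘ₗ canonicalMap A M n =
      (canonicalAlgHom A M).toLinearMap ∘ₗ (Gam A M n).subtype :=
    LinearMap.ext fun y => of_canonicalMap n y
  rw [← LinearMap.range_comp, h, LinearMap.range_comp, Submodule.range_subtype,
    ← span_prod_dp hm, Submodule.map_span]
  congr 1
  ext z
  constructor
  · rintro ⟨_, ⟨ν, hν, rfl⟩, rfl⟩
    exact ⟨ν, hν, canonicalAlgHom_prod_dp m ν⟩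
  · rintro ⟨ν, hν, rfl⟩
    exact ⟨_, ⟨ν, hν, rfl⟩, canonicalAlgHom_prod_dp m ν⟩

/-! ### Coordinates of the shuffle monomials -/

section Coordinates

variable (A M) in
/-- The sum of all the maps `spread n k`, which turns shuffle products into products, as an algebra
homomorphism. -/
def spreadAlgHom [Module Aᵐᵒᵖ M] [IsCentralScalar A M] (n : ℕ) :
    (⨁ k, TS A M k) →ₐ[A] Aux A M n :=
  DirectSum.toAlgebra A (fun k => TS A M k) (fun k => spread n k ∘ₗ (TS A M k).subtype)
    (spread_zero_one n) (fun x y => spread_shuffle n x.1 y.1)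

lemma spreadAlgHom_of [Module Aᵐᵒᵖ M] [IsCentralScalar A M] (n k : ℕ) (x : TS A M k) :
    (spreadAlgHom A M n (DirectSum.of (fun k => TS A M k) k x) : Aux A M n) = spread n k x.1 :=
  DirectSum.toModule_lof A (φ := fun k => spread n k ∘ₗ (TS A M k).subtype) k x

lemma topProj_spreadAlgHom [Module Aᵐᵒᵖ M] [IsCentralScalar A M] (n : ℕ) (z : ⨁ k, TS A M k) :
    topProj n (spreadAlgHom A M n z) = (z n).1 := by
  induction z using DirectSum.induction_on with
  | zero => simp
  | of k z =>
    rw [spreadAlgHom_of]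
    by_cases hk : k = n
    · subst hk
      rw [top_spread_self, DirectSum.of_eq_same]
    · rw [top_spread_ne hk, DirectSum.of_eq_of_ne _ _ _ (Ne.symm hk)]
      rfl
  | add x y hx hy => simp [hx, hy]

variable {n : ℕ} (φ : Fin n → M →ₗ[A] A)

/-- The functional `x₁ ⊗ … ⊗ xₙ ↦ ∏ⱼ φⱼ(xⱼ)` on the tensor power. -/
def dualProd : ⨂[A]^n M →ₗ[A] A :=
  (PiTensorProduct.constantBaseRingEquiv (Fin n) A).toLinearMap ∘ₗ PiTensorProduct.map φ

lemma dualProd_tprod (x : Fin n → M) :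
    dualProd φ (PiTensorProduct.tprod A x) = ∏ j, φ j (x j) := by
  simp [dualProd]

/-- The homomorphism of auxiliary rings that applies `φⱼ` to the `j`-th tensor factor. -/
def auxMap [Module Aᵐᵒᵖ M] [IsCentralScalar A M] : Aux A M n →ₐ[A] Aux A A n :=
  PiTensorProduct.liftAlgHom
    ((PiTensorProduct.tprod A).compLinearMap fun j => (TrivSqZeroExt.map (φ j)).toLinearMap)
    (congrArg (PiTensorProduct.tprod A) (funext fun j => map_one (TrivSqZeroExt.map (φ j))))
    (fun x y => (congrArg (PiTensorProduct.tprod A)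
      (funext fun j => map_mul (TrivSqZeroExt.map (φ j)) (x j) (y j))).trans
        (PiTensorProduct.tprod_mul_tprod _ _).symm)

lemma auxMap_tprod [Module Aᵐᵒᵖ M] [IsCentralScalar A M] (x : Fin n → TrivSqZeroExt A M) :
    auxMap φ (PiTensorProduct.tprod A x) =
      PiTensorProduct.tprod A fun j => TrivSqZeroExt.map (φ j) (x j) :=
  PiTensorProduct.lift.tprod _

lemma auxMap_eps [Module Aᵐᵒᵖ M] [IsCentralScalar A M] (j : Fin n) (x : M) :
    auxMap φ (eps j x) = eps j (φ j x) := by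
  rw [eps_apply, eps_apply, auxMap_tprod]
  congr 1
  funext i
  by_cases h : i = j
  · subst h
    simp
  · simp [Pi.mulSingle_eq_of_ne h]

/-- The instance of `map_prod` for `auxMap`, which instance search does not find: the two paths to
the multiplicative structure of the auxiliary rings agree only by unfolding. -/
lemma auxMap_prod [Module Aᵐᵒᵖ M] [IsCentralScalar A M] {κ : Type*} (s : Finset κ)
    (x : κ → Aux A M n) : auxMap φ (∏ k ∈ s, x k) = ∏ k ∈ s, auxMap φ (x k) := by
  classical
  induction s using Finset.induction_on with
  | empty => exact (auxMap φ).map_one'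
  | insert k s hk ih =>
    rw [Finset.prod_insert hk, Finset.prod_insert hk, ← ih]
    exact map_mul (auxMap φ) _ _

lemma spreadAlgHom_prod [Module Aᵐᵒᵖ M] [IsCentralScalar A M] {κ : Type*} (s : Finset κ)
    (x : κ → ⨁ k, TS A M k) :
    spreadAlgHom A M n (∏ k ∈ s, x k) = ∏ k ∈ s, spreadAlgHom A M n (x k) :=
  map_prod (spreadAlgHom A M n) _ _

lemma dualProd_topProj [Module Aᵐᵒᵖ M] [IsCentralScalar A M] (a : Aux A M n) :
    dualProd φ (topProj n a) =
      PiTensorProduct.constantBaseRingEquiv (Fin n) A (topProj n (auxMap φ a)) := by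
  induction a using PiTensorProduct.induction_on with
  | smul_tprod r x =>
    simp only [map_smul, auxMap_tprod, topProj, PiTensorProduct.map_tprod, dualProd_tprod]
    simp [PiTensorProduct.constantBaseRingEquiv_tprod]
  | add x y hx hy => simp only [map_add, hx, hy]

lemma topProj_prod_eps (c : Fin n → M) [Module Aᵐᵒᵖ M] [IsCentralScalar A M] :
    topProj n (∏ j, eps j (c j) : Aux A M n) = PiTensorProduct.tprod A c := by
  rw [← place_tprod (fun j => j), place_tprod_eq, topProj, PiTensorProduct.map_tprod]
  congr 1
  funext j
  rw [Finset.prod_apply, Finset.prod_eq_single j]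
  · simp
  · intro b _ hb
    simp [hb.symm]
  · simp

variable {ι : Type*}

/-- The multiindex `i ↦ #f⁻¹(i)` of a map `f : {1, …, n} → ι`. -/
def fiberCount (f : Fin n → ι) : ι →₀ ℕ := ∑ j, Finsupp.single (f j) 1

lemma fiberCount_apply [DecidableEq ι] (f : Fin n → ι) (i : ι) :
    fiberCount f i = (Finset.univ.filter fun j => f j = i).card := by
  simp [fiberCount, Finsupp.finsetSum_apply, Finsupp.single_apply]

lemma degree_fiberCount (f : Fin n → ι) : (fiberCount f).degree = n := by
  simp [fiberCount]

lemma exists_fiberCount_eq (ν : ι →₀ ℕ) (h : ν.degree = n) : ∃ f : Fin n → ι, fiberCount f = ν := by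
  classical
  obtain ⟨l, hl⟩ : ∃ l : List ι, (l : Multiset ι) = Finsupp.toMultiset ν :=
    ⟨_, Multiset.coe_toList _⟩
  have hlen : l.length = n := by
    rw [← h, ← Multiset.coe_card, hl, Finsupp.card_toMultiset]
    rfl
  subst hlen
  refine ⟨fun j => l[j], Multiset.toFinsupp.symm.injective ?_⟩
  change Finsupp.toMultiset _ = Finsupp.toMultiset ν
  rw [← hl, fiberCount, map_sum]
  simp only [Finsupp.toMultiset_single, one_smul]
  exact (Fin.sum_univ_fun_getElem l fun i => ({i} : Multiset ι)).trans
    (Multiset.sum_map_singleton (l : Multiset ι))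

/-- Maps with equal fibre counts differ by a permutation of the source. -/
lemma exists_perm_of_fiberCount_eq {f g : Fin n → ι} (h : fiberCount f = fiberCount g) :
    ∃ σ : Equiv.Perm (Fin n), g ∘ σ = f := by
  classical
  have e : ∀ i, Nonempty ({j // f j = i} ≃ {j // g j = i}) := fun i => by
    have hi := DFunLike.congr_fun h i
    rw [fiberCount_apply, fiberCount_apply] at hi
    exact Fintype.card_eq.1 (by simpa only [Fintype.card_subtype] using hi)
  exact ⟨Equiv.ofFiberEquiv fun i => (e i).some, funext fun j => Equiv.ofFiberEquiv_map _ j⟩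

lemma exists_lt_of_degree_eq {μ ν : ι →₀ ℕ} (h : μ.degree = ν.degree) (hne : μ ≠ ν) :
    ∃ i, μ i < ν i := by
  by_contra! hle
  obtain ⟨κ, rfl⟩ := exists_add_of_le (Finsupp.le_def.2 hle : ν ≤ μ)
  rw [map_add, Nat.add_eq_left] at h
  rw [(Finsupp.degree_eq_zero_iff _).1 h, add_zero] at hne
  exact hne rfl

/-- Let `φ` be dual to `(e_{f 1}, …, e_{f n})` in the sense that `φⱼ(eᵢ)` is `1` for `i = f j` and
`0` otherwise. The coefficient of a shuffle monomial `e_ν` of degree `n` at `f` is `1` if `ν` counts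
the fibres of `f`, and `0` otherwise: in the auxiliary ring, `φ` maps `e_ν` to the product over `i`
of the elementary symmetric polynomials of degree `νᵢ` in the square-zero elements `εⱼ` with
`f j = i`. -/
lemma dualProd_shuffleMonomial [DecidableEq ι] (e : ι → M) (f : Fin n → ι)
    (hφ : ∀ j i, φ j (e i) = if f j = i then 1 else 0) (ν : ι →₀ ℕ) (hν : ν.degree = n) :
    dualProd φ (shuffleMonomial (A := A) e ν n).1 = if fiberCount f = ν then 1 else 0 := by
  -- the auxiliary ring needs a right action of `A` on `M`
  let _ : Module Aᵐᵒᵖ M := Module.compHom _ ((RingHom.id A).fromOpposite mul_comm)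
  have _ : IsCentralScalar A M := ⟨fun r m => rfl⟩
  -- `φ` maps `e_i ^ ⊗ k` to the elementary symmetric polynomial in the `εⱼ` with `f j = i`
  have hE : ∀ i k, auxMap φ (spreadAlgHom A M n (tsPow A k (e i))) =
      ∑ S ∈ Finset.powersetCard k (Finset.univ.filter fun j => f j = i),
        ∏ j ∈ S, (eps j (1 : A) : Aux A A n) := by
    intro i k
    rw [tsPow, spreadAlgHom_of, spread_tensorPow, map_sum]
    symm
    refine Finset.sum_subset_zero_on_sdiff (Finset.powersetCard_mono (Finset.subset_univ _)) ?_ ?_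
    · intro S hS
      simp only [Finset.mem_sdiff, Finset.mem_powersetCard, Finset.subset_univ, true_and,
        not_and'] at hS
      obtain ⟨j, hj, hji⟩ := Finset.not_subset.1 (hS.2 hS.1)
      rw [auxMap_prod]
      have h0 : auxMap φ (eps j (e i)) = 0 := by
        rw [auxMap_eps, hφ, if_neg (by simpa using hji), map_zero]
      exact Finset.prod_eq_zero (M₀ := Aux A A n) hj h0
    · intro S hS
      rw [auxMap_prod]
      refine Finset.prod_congr rfl fun j hj => ?_
      rw [auxMap_eps, hφ, if_pos (by simpa using (Finset.mem_powersetCard.1 hS).1 hj)]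
  rw [← topProj_spreadAlgHom, dualProd_topProj, shuffleMonomial, Finsupp.prod, spreadAlgHom_prod,
    auxMap_prod]
  simp only [hE]
  split_ifs with h
  · -- each factor is a single monomial, the product of the `εⱼ` over a fibre of `f`
    subst h
    have : ∀ i ∈ (fiberCount f).support,
        ∑ S ∈ Finset.powersetCard (fiberCount f i) (Finset.univ.filter fun j => f j = i),
          ∏ j ∈ S, (eps j (1 : A) : Aux A A n) = ∏ j with f j = i, eps j (1 : A) := by
      intro i _
      rw [fiberCount_apply, Finset.powersetCard_self, Finset.sum_singleton]
    rw [Finset.prod_congr rfl this, Finset.prod_fiberwise_of_maps_to, topProj_prod_eps]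
    · simp
    · intro j _
      rw [Finsupp.mem_support_iff, fiberCount_apply]
      exact Finset.card_ne_zero.2 ⟨j, by simp⟩
  · -- some factor has degree greater than its number of variables, hence vanishes
    obtain ⟨i, hi⟩ := exists_lt_of_degree_eq ((degree_fiberCount f).trans hν.symm) h
    have hi0 : ∑ S ∈ Finset.powersetCard (ν i) (Finset.univ.filter fun j => f j = i),
        ∏ j ∈ S, (eps j (1 : A) : Aux A A n) = 0 := by
      rw [Finset.powersetCard_eq_empty.2 (by rwa [← fiberCount_apply]), Finset.sum_empty]
    have hp := Finset.prod_eq_zero (M₀ := Aux A A n)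
      (f := fun i => ∑ S ∈ Finset.powersetCard (ν i) (Finset.univ.filter fun j => f j = i),
        ∏ j ∈ S, (eps j (1 : A) : Aux A A n))
      (Finsupp.mem_support_iff.2 (Nat.ne_zero_of_lt hi)) hi0
    exact (congrArg
      (fun a => PiTensorProduct.constantBaseRingEquiv (Fin n) A (topProj n a)) hp).trans (by
        rw [map_zero, map_zero])

end Coordinates

/-! ### The canonical map of a free module -/

section Free

variable {ι : Type*} (b : Module.Basis ι A M) {n : ℕ}

lemma piTensorProduct_repr_eq_dualProd (f : Fin n → ι) (z : ⨂[A]^n M) :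
    (Basis.piTensorProduct fun _ => b).repr z f = dualProd (fun j => b.coord (f j)) z := by
  induction z using tensor_induction with
  | hs r x => simp [dualProd_tprod]
  | ha x y hx hy => simp only [map_add, Finsupp.add_apply, hx, hy]

lemma piTensorProduct_repr_permute (σ : Equiv.Perm (Fin n)) (f : Fin n → ι) (z : ⨂[A]^n M) :
    (Basis.piTensorProduct fun _ => b).repr (permute A M n σ z) f =
      (Basis.piTensorProduct fun _ => b).repr z (f ∘ σ) := by
  induction z using tensor_induction with
  | hs r x =>
    simp only [map_smul, permute_tprod, Finsupp.smul_apply,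
      Basis.piTensorProduct_repr_tprod_apply]
    rw [← Equiv.prod_comp σ]
    simp
  | ha x y hx hy => simp only [map_add, Finsupp.add_apply, hx, hy]

lemma repr_shuffleMonomial [DecidableEq ι] (f : Fin n → ι) {ν : ι →₀ ℕ} (hν : ν.degree = n) :
    (Basis.piTensorProduct fun _ => b).repr (shuffleMonomial (A := A) b ν n).1 f =
      if fiberCount f = ν then 1 else 0 := by
  rw [piTensorProduct_repr_eq_dualProd]
  refine dualProd_shuffleMonomial _ b f (fun j i => ?_) ν hν
  simp [Finsupp.single_apply, eq_comm]

/-- A symmetric tensor over a free module is the combination of the shuffle monomials in the basis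
vectors, the coefficient of `e_ν` being the coordinate at any `f` with fibre counts `ν`. -/
lemma canonicalMap_surjective_of_basis {ι : Type*} (b : Module.Basis ι A M) (n : ℕ) :
    Function.Surjective (canonicalMap A M n) := by
  classical
  intro z
  set B := Basis.piTensorProduct fun _ : Fin n => b with hB
  have hc : (B.repr z.1 : (Fin n → ι) → A).FactorsThrough fiberCount := by
    intro f g h
    obtain ⟨σ, rfl⟩ := exists_perm_of_fiberCount_eq h
    rw [hB, ← piTensorProduct_repr_permute, z.2 σ]
  -- the coefficient of `e_ν` is the common value of the coordinates of `z` on the fibre of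
  -- `fiberCount` over `ν`; only fibres that meet the support contribute
  set S := (B.repr z.1).support.image fiberCount with hS
  have hdeg : ∀ ν ∈ S, ν.degree = n := by
    intro ν hν
    obtain ⟨f, -, rfl⟩ := Finset.mem_image.1 hν
    exact degree_fiberCount f
  have hz : z = ∑ ν ∈ S, Function.extend fiberCount (B.repr z.1) 0 ν •
      shuffleMonomial (A := A) b ν n := by
    refine Subtype.ext (B.repr.injective (Finsupp.ext fun f => ?_))
    rw [AddSubmonoidClass.coe_finsetSum, map_sum, Finsupp.finsetSum_apply]
    have : ∀ ν ∈ S, B.repr (Function.extend fiberCount (B.repr z.1) 0 ν •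
        shuffleMonomial (A := A) b ν n : TS A M n).1 f =
        if fiberCount f = ν then B.repr z.1 f else 0 := by
      intro ν hν
      rw [Submodule.coe_smul, map_smul, Finsupp.smul_apply, hB,
        repr_shuffleMonomial b f (hdeg ν hν)]
      split_ifs with h
      · rw [← h, hc.extend_apply, smul_eq_mul, mul_one]
      · rw [smul_zero]
    rw [Finset.sum_congr rfl this, Finset.sum_ite_eq]
    split_ifs with h
    · rfl
    · by_contra hne
      exact h (Finset.mem_image_of_mem _ (Finsupp.mem_support_iff.2 hne))
  rw [← LinearMap.mem_range, hz]
  refine Submodule.sum_mem _ fun ν hν => Submodule.smul_mem _ _ ?_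
  refine ⟨⟨ν.prod fun i k => dp A k (b i), hdeg ν hν ▸ prod_dp_mem b ν⟩, ?_⟩
  rw [canonicalMap_eq, canonicalAlgHom_prod_dp]

/-- The coordinate of the image of `∑ l_ν γ^ν(e)` at `f` is `l_ν` for `ν` the fibre counts of `f`,
so that an element of the kernel has zero coefficients. -/
lemma canonicalMap_injective_of_basis {ι : Type*} (b : Module.Basis ι A M) (n : ℕ) :
    Function.Injective (canonicalMap A M n) := by
  classical
  refine (injective_iff_map_eq_zero _).2 fun y hy => Subtype.ext ?_
  have hspan := (span_prod_dp b.span_eq n).ge y.2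
  have himage : {z | ∃ ν : ι →₀ ℕ, ν.degree = n ∧ z = ν.prod fun i k => dp A k (b i)} =
      (fun ν : ι →₀ ℕ => ν.prod fun i k => dp A k (b i)) '' {ν | ν.degree = n} := by
    ext z
    simp only [Set.mem_ofPred_eq, Set.mem_image, eq_comm]
  rw [himage, Finsupp.mem_span_image_iff_linearCombination] at hspan
  obtain ⟨l, hl, hly⟩ := hspan
  have hcoord : ∀ f : Fin n → ι, l (fiberCount f) = 0 := by
    intro f
    let c : (⨁ k, TS A M k) →ₗ[A] A := Finsupp.lapply f ∘ₗ
      (Basis.piTensorProduct fun _ : Fin n => b).repr.toLinearMap ∘ₗ (TS A M n).subtype ∘ₗ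
        DirectSum.component A ℕ (fun k => TS A M k) n
    have h0 : c (canonicalAlgHom A M y) = 0 := by
      change (Basis.piTensorProduct fun _ : Fin n => b).repr (canonicalMap A M n y).1 f = 0
      rw [hy]
      simp
    rw [← hly, Finsupp.linearCombination_apply, Finsupp.sum, map_sum, map_sum] at h0
    rw [← h0]
    have : ∀ ν ∈ l.support, c (canonicalAlgHom A M (l ν • ν.prod fun i k => dp A k (b i))) =
        if fiberCount f = ν then l ν else 0 := by
      intro ν hν
      rw [map_smul, map_smul, canonicalAlgHom_prod_dp]
      refine (congrArg (l ν • ·) (repr_shuffleMonomial b f (hl hν))).trans ?_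
      simp
    rw [Finset.sum_congr rfl this, Finset.sum_ite_eq]
    split_ifs with h
    · rfl
    · exact Finsupp.notMem_support_iff.1 h
  have hl0 : l = 0 := by
    ext ν
    by_contra hne
    obtain ⟨f, rfl⟩ := exists_fiberCount_eq ν (hl (Finsupp.mem_support_iff.2 hne))
    exact hne (hcoord f)
  rw [← hly, hl0, map_zero]
  rfl

lemma canonicalMap_bijective (A M : Type*) [CommRing A] [AddCommGroup M] [Module A M]
    [Module.Free A M] (n : ℕ) : Function.Bijective (canonicalMap A M n) :=
  ⟨canonicalMap_injective_of_basis (Module.Free.chooseBasis A M) n,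
    canonicalMap_surjective_of_basis (Module.Free.chooseBasis A M) n⟩

end Free

/-! ### The canonical map and presentations -/

section Presentation

variable {F : Type*} [AddCommGroup F] [Module A F] {q : F →ₗ[A] M}

/-- Symmetric tensors that map to zero are the invariants of the kernel on the tensor powers. -/
lemma ker_tsMap (n : ℕ) : LinearMap.ker (tsMap q n) = kernelInvariants q n := by
  ext z
  exact Subtype.ext_iff

lemma tsMap_comp_canonicalMap (n : ℕ) :
    tsMap q n ∘ₗ canonicalMap A F n = canonicalMap A M n ∘ₗ gamMap q n :=
  LinearMap.ext (tsMap_canonicalMap q n)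

lemma canonicalMap_injective_iff [Module.Free A F] (hq : Function.Surjective q) (n : ℕ) :
    Function.Injective (canonicalMap A M n) ↔ kernelK q n = kernelInvariants q n := by
  have hF := canonicalMap_bijective A F n
  have hker : kernelInvariants q n =
      (LinearMap.ker (canonicalMap A M n ∘ₗ gamMap q n)).map (canonicalMap A F n) := by
    rw [← tsMap_comp_canonicalMap, LinearMap.ker_comp, ker_tsMap,
      Submodule.map_comap_eq_of_surjective hF.2]
  rw [hker, kernelK, (Submodule.map_injective_of_injective hF.1).eq_iff]
  constructor
  · intro h
    rw [LinearMap.ker_comp, LinearMap.ker_eq_bot'.2 fun y => (injective_iff_map_eq_zero _).1 h y]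
    rfl
  · intro h
    refine (injective_iff_map_eq_zero _).2 fun y hy => ?_
    obtain ⟨x, rfl⟩ := gamMap_surjective hq n y
    exact LinearMap.mem_ker.1 (h.ge (LinearMap.mem_ker.2 hy))

lemma range_canonicalMap [Module.Free A F] (hq : Function.Surjective q) (n : ℕ) :
    LinearMap.range (canonicalMap A M n) = LinearMap.range (tsMap q n) := by
  rw [← LinearMap.range_comp_of_range_eq_top _
      (LinearMap.range_eq_top.2 (gamMap_surjective hq n)), ← tsMap_comp_canonicalMap,
    LinearMap.range_comp_of_range_eq_top _
      (LinearMap.range_eq_top.2 (canonicalMap_bijective A F n).2)]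

end Presentation

end SymTensor
end

theorem mainTheorem7 {A : Type*} [CommRing A] {P F M : Type*}
    [AddCommGroup P] [Module A P] [AddCommGroup F] [Module A F] [Module.Free A F]
    [AddCommGroup M] [Module A M]
    (i : P →ₗ[A] F) (q : F →ₗ[A] M) (hi : Function.Injective i) (hiq : Function.Exact i q)
    (hq : Function.Surjective q) (n : ℕ) :
    ((LinearMap.ker (SymTensor.gamMap q n)).map (SymTensor.Gam A F n).subtype =
      Submodule.span A {z | ∃ s, 1 ≤ s ∧ s ≤ n ∧ ∃ (p : P), ∃ y ∈ SymTensor.Gam A F (n - s),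
        z = DividedPowerAlgebra.dp A s (i p) * y}) ∧
    (Function.Injective (SymTensor.canonicalMap A M n) ↔
      SymTensor.kernelK q n = SymTensor.kernelInvariants q n) ∧
    (Function.Surjective (SymTensor.canonicalMap A M n) ↔
      Function.Surjective (SymTensor.tsMap q n)) ∧
    ∀ {ι : Type*} (m : ι → M), Submodule.span A (Set.range m) = ⊤ →
      (LinearMap.range (SymTensor.tsMap q n)).map
          (DirectSum.lof A ℕ (fun k => SymTensor.TS A M k) n) =
        Submodule.span A
          {z | ∃ ν : ι →₀ ℕ, ν.degree = n ∧ z = SymTensor.shuffleMonomial m ν} := by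
  refine ⟨?_, SymTensor.canonicalMap_injective_iff hq n, ?_, fun m hm => ?_⟩
  · rw [SymTensor.ker_gamMap hq]
    congr 1
    ext z
    constructor
    · rintro ⟨s, hs, hsn, p, hp, y, hy, rfl⟩
      obtain ⟨p, rfl⟩ := (hiq p).1 hp
      exact ⟨s, hs, hsn, p, y, hy, rfl⟩
    · rintro ⟨s, hs, hsn, p, y, hy, rfl⟩
      exact ⟨s, hs, hsn, i p, hiq.apply_apply_eq_zero p, y, hy, rfl⟩
  · rw [← LinearMap.range_eq_top, ← LinearMap.range_eq_top, SymTensor.range_canonicalMap hq]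
  · rw [← SymTensor.range_canonicalMap hq]
    exact SymTensor.map_lof_range_canonicalMap hm n
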